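/- Let $F$ be a non-archimedean local field of characteristic $2$ with residue field $\mathbb F_q$, and let $E/F$ be a totally ramified Galois extension of degree $2$ with discriminant $\mathfrak p_F^{d+1}$, where $d>0$ is odd. Let $\tau$ be the non-trivial element of $\mathrm{Gal}(E/F)$. Let $\varpi$, $\pi$ be uniformizers of $F$, $E$ with $\pi^2+\Delta\pi+\varpi=0$, where $\Delta\in F$ and $\mathrm{ord}_F(\Delta)=\frac{d+1}{2}$, and put $\varepsilon=\tau(\pi)/\pi$. Let $\iota\colon E\hookrightarrow M_2(F)$ be the $F$-algebra embedding with $\iota(\pi)=\begin{pmatrix}\Delta&1\\ \varpi&0\end{pmatrix}$. For $L\in\{F,E\}$ let $I_L=\begin{pmatrix}\mathcal O_L^\times&\mathcal O_L\\ \mathfrak p_L&\mathcal O_L^\times\end{pmatrix}$ and, for $k\ge 0$, let $I_L^k$ be the subgroup of all $g\in I_L$ with $g-1\in\begin{pmatrix}\mathfrak p_L^{\lfloor (k+1)/2\rfloor}&\mathfrak p_L^{\lfloor k/2\rfloor}\\ \mathfrak p_L^{\lfloor k/2\rfloor+1}&\mathfrak p_L^{\lfloor (k+1)/2\rfloor}\end{pmatrix}$.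 Let $Z(E)$ be the centre of $\mathrm{GL}_2(E)$. Let $n\ge 1$ be an integer with $2n>d$, put $m=2n+d-1$, $J=I_E^{2m+1}$, and $$\dot w=\begin{pmatrix}0&\pi^{-n}\\ \pi^n&0\end{pmatrix}\begin{pmatrix}\varepsilon^{\lfloor n/2\rfloor}&0\\0&\varepsilon^{-\lfloor (n+1)/2\rfloor}\end{pmatrix},\qquad \dot v=\begin{pmatrix}0&\pi^{-(\frac{d+1}{2}+\lfloor\frac{n+1}{2}\rfloor)}\\ \pi^{\frac{d+1}{2}+\lfloor\frac n2\rfloor}&0\end{pmatrix}.$$ Let $X=\{gJ\in \mathrm{GL}_2(E)/J:\ g^{-1}\tau(g)\in J\dot wJ\}$ (the extended affine Deligne--Lusztig variety $X_{\dot w}^m(1)$, a discrete set). The group $\mathrm{GL}_2(F)$ acts on $X$ by left multiplication, and $\widetilde\Gamma=\{i\in Z(E)I_E/J:\ i^{-1}J\dot wJ\tau(i)=J\dot wJ\}$ acts on $X$ by right multiplication. Let $X_{P_{1/2}}\subseteq X$ be the set of all points of $X$ of the form $\begin{pmatrix}1&0\\a&1\end{pmatrix}\dot v\,k\,J$ with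 $a\in E$, $\mathrm{ord}_E(a)=1$, $k\in I_E$, and let $\widetilde X=X_{P_{1/2}}\cdot\widetilde\Gamma$. Let $\ell$ be a prime, let $\theta\colon E^\times\to\overline{\mathbb Q}_\ell^\times$ be a character of level $m$ (that is, $m$ is the least integer $\geq 0$ such that $\theta$ is trivial on $U_E^{m+1}=1+\mathfrak p_E^{m+1}$), and let $\tilde\theta\colon\widetilde\Gamma\to\overline{\mathbb Q}_\ell^\times$ be a character lifting $\theta$, i.e. $\tilde\theta(\mathrm{diag}(t,\tau(t)))=\theta(t)$ for all $t\in E^\times$. For a $\widetilde\Gamma$-stable subset $Y\subseteq X$ let $H^0_c(Y)$ be the space of finitely supported functions $Y\to\overline{\mathbb Q}_\ell$, with the actions for which $g$ and $\gamma$ send the characteristic function of a point $y$ to that of $gy$ and $y\gamma$ respectively, and let $H^0_c(Y)[\tilde\theta]$ be the largest quotient of $H^0_c(Y)$ on which every $\gamma\in\widetilde\Gamma$ acts as the scalar $\tilde\theta(\gamma)$. Put $$R_{\tilde\theta}=H^0_c(X)[\tilde\theta],\qquad V_{\tilde\theta}=H^0_c(\widetilde X)[\tilde\theta].$$ Then: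 1. $R_{\tilde\theta}\neq 0$ and the central character of the $\mathrm{GL}_2(F)$-representation $R_{\tilde\theta}$ is $\theta|_{F^\times}$; 2. $\widetilde X$ is stable under $\iota(E^\times)I_F$, and the resulting representation $\Xi_{\tilde\theta}$ of $\iota(E^\times)I_F$ in $V_{\tilde\theta}$ is trivial on $I_F^{m+d+1}$; 3. $\dim_{\overline{\mathbb Q}_\ell}V_{\tilde\theta}=(q-1)q^{n+d-1}$, and in particular $V_{\tilde\theta}$ is finite-dimensional. -/

import Mathlib

open scoped ValuativeRel MatrixGroups

namespace WildGL2

/-! ### Isotypic parts of spaces of finitely supported functions -/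

section Isotypic

variable (K : Type*) [Field K] {Γ α : Type*} [Group Γ] [MulAction Γᵐᵒᵖ α]

/-- For a set `Y` (viewed as a discrete space) the space `Y →₀ K` of finitely supported functions
is `H⁰_c(Y, K)`.  If `Γ` acts on `Y` from the right, `γ` sends the characteristic function of `{x}`
to that of `{x γ}`.  This is the span of all `φ·γ - χ(γ) φ`. -/
noncomputable def isotypicRelations (Y : SubMulAction Γᵐᵒᵖ α) (χ : Γ →* Kˣ) : Submodule K (Y →₀ K) :=
  Submodule.span K {f | ∃ (γ : Γ) (φ : Y →₀ K),
    f = Finsupp.lmapDomain K K (fun x : Y => MulOpposite.op γ • x) φ - (χ γ : K) • φ}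

/-- `H⁰_c(Y, K)[χ]`: the `χ`-isotypic part of `H⁰_c(Y, K)`, i.e. its largest quotient on which
every `γ` acts through the scalar `χ(γ)`. -/
abbrev IsotypicPart (Y : SubMulAction Γᵐᵒᵖ α) (χ : Γ →* Kˣ) : Type _ :=
  (Y →₀ K) ⧸ isotypicRelations K Y χ

variable {H : Type*} [Group H] [MulAction H α] [SMulCommClass H Γᵐᵒᵖ α]

/-- The left action of `H` on `H⁰_c(Y, K)`, `(g φ)(x) = φ(g⁻¹ x)`, for an `H`-stable set `Y`. -/
noncomputable def functionRep (Y : SubMulAction Γᵐᵒᵖ α) (hY : ∀ g : H, ∀ x ∈ Y, g • x ∈ Y) :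
    Representation K H (Y →₀ K) where
  toFun g := Finsupp.lmapDomain K K (fun x : Y => (⟨g • (x : α), hY g x x.2⟩ : Y))
  map_one' := by
    refine LinearMap.ext fun φ => ?_
    simp only [one_smul, Finsupp.lmapDomain_apply, Module.End.one_apply]
    exact Finsupp.mapDomain_id
  map_mul' g h := by
    refine LinearMap.ext fun φ => ?_
    simp only [mul_smul, Finsupp.lmapDomain_apply, Module.End.mul_apply]
    exact Finsupp.mapDomain_comp (f := fun x : Y => (⟨h • (x : α), hY h x x.2⟩ : Y))
      (g := fun x : Y => (⟨g • (x : α), hY g x x.2⟩ : Y))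

/-- The representation of `H` on `H⁰_c(Y, K)[χ]` induced by the left action of `H` on `Y`. -/
noncomputable def isotypicRep (Y : SubMulAction Γᵐᵒᵖ α) (hY : ∀ g : H, ∀ x ∈ Y, g • x ∈ Y)
    (χ : Γ →* Kˣ) : Representation K H (IsotypicPart K Y χ) :=
  (functionRep K Y hY).quotient (isotypicRelations K Y χ) (by
    intro g
    rw [isotypicRelations, Submodule.span_le]
    rintro _ ⟨γ, φ, rfl⟩
    refine Submodule.subset_span ⟨γ, functionRep K Y hY g φ, ?_⟩
    rw [map_sub, map_smul]
    congr 1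
    simp only [functionRep, MonoidHom.coe_mk, OneHom.coe_mk, Finsupp.lmapDomain_apply,
      ← Finsupp.mapDomain_comp]
    congr 1
    funext x
    exact Subtype.ext (smul_comm g (MulOpposite.op γ) (x : α)))

end Isotypic

/-! ### Filtrations of a local field and of the Iwahori subgroup -/

section Local

variable (L : Type*) [Field L] [ValuativeRel L]

/-- The power `𝔭_L ^ k` of the maximal ideal of `𝒪_L`, as a subgroup of `L`. -/
noncomputable def maxPow (k : ℕ) : AddSubgroup L :=
  (Submodule.toAddSubgroup (𝓂[L] ^ k : Ideal 𝒪[L])).map (𝒪[L].subtype : 𝒪[L] →+ L)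

variable {L} in
/-- `ord_L(x) = k`. -/
def HasOrd (x : L) (k : ℕ) : Prop := x ∈ maxPow L k ∧ x ∉ maxPow L (k + 1)

variable {L} in
/-- The character `χ` of `Lˣ` has level `k`: `k` is the smallest natural number such that `χ` is
trivial on `U_L ^ (k + 1) = 1 + 𝔭_L ^ (k + 1)`. -/
def HasLevel {A : Type*} [Group A] (χ : Lˣ →* A) (k : ℕ) : Prop :=
  IsLeast {j : ℕ | ∀ u : Lˣ, (u : L) - 1 ∈ maxPow L (j + 1) → χ u = 1} k

/-- The `k`-th power of the radical of the chain order `[[𝒪, 𝒪], [𝔭, 𝒪]]`: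
the matrices with entries in `[[𝔭^⌊(k+1)/2⌋, 𝔭^⌊k/2⌋], [𝔭^(⌊k/2⌋+1), 𝔭^⌊(k+1)/2⌋]]`. -/
noncomputable def chainPow (k : ℕ) : AddSubgroup (Matrix (Fin 2) (Fin 2) L) where
  carrier := {x | x 0 0 ∈ maxPow L ((k + 1) / 2) ∧ x 0 1 ∈ maxPow L (k / 2) ∧
    x 1 0 ∈ maxPow L (k / 2 + 1) ∧ x 1 1 ∈ maxPow L ((k + 1) / 2)}
  zero_mem' := by simp
  add_mem' := by
    rintro x y ⟨h1, h2, h3, h4⟩ ⟨h1', h2', h3', h4'⟩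
    exact ⟨add_mem h1 h1', add_mem h2 h2', add_mem h3 h3', add_mem h4 h4'⟩
  neg_mem' := by
    rintro x ⟨h1, h2, h3, h4⟩
    exact ⟨neg_mem h1, neg_mem h2, neg_mem h3, neg_mem h4⟩

variable {L}

theorem maxPow_anti {j k : ℕ} (h : j ≤ k) : maxPow L k ≤ maxPow L j :=
  AddSubgroup.map_mono fun _ hx => Ideal.pow_le_pow_right h hx

theorem mul_mem_maxPow {i j k : ℕ} (h : k ≤ i + j) {x y : L} (hx : x ∈ maxPow L i)
    (hy : y ∈ maxPow L j) : x * y ∈ maxPow L k := by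
  refine maxPow_anti h ?_
  obtain ⟨x, hx, rfl⟩ := hx
  obtain ⟨y, hy, rfl⟩ := hy
  refine ⟨x * y, ?_, rfl⟩
  change x * y ∈ 𝓂[L] ^ (i + j)
  rw [pow_add]
  exact Ideal.mul_mem_mul hx hy

theorem one_mem_maxPow_zero : (1 : L) ∈ maxPow L 0 := ⟨1, by simp, rfl⟩

theorem mul_mem_chainPow {i j k : ℕ} (h : i = 0 ∧ j = k ∨ i = k ∧ j = 0)
    {x y : Matrix (Fin 2) (Fin 2) L} (hx : x ∈ chainPow L i) (hy : y ∈ chainPow L j) :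
    x * y ∈ chainPow L k := by
  obtain ⟨h1, h2, h3, h4⟩ := hx
  obtain ⟨h1', h2', h3', h4'⟩ := hy
  refine ⟨?_, ?_, ?_, ?_⟩ <;> rw [Matrix.mul_apply, Fin.sum_univ_two]
  · exact add_mem (mul_mem_maxPow (by omega) h1 h1') (mul_mem_maxPow (by omega) h2 h3')
  · exact add_mem (mul_mem_maxPow (by omega) h1 h2') (mul_mem_maxPow (by omega) h2 h4')
  · exact add_mem (mul_mem_maxPow (by omega) h3 h1') (mul_mem_maxPow (by omega) h4 h3')
  · exact add_mem (mul_mem_maxPow (by omega) h3 h2') (mul_mem_maxPow (by omega) h4 h4')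

theorem one_mem_chainPow_zero : (1 : Matrix (Fin 2) (Fin 2) L) ∈ chainPow L 0 := by
  refine ⟨?_, ?_, ?_, ?_⟩ <;> simp [one_mem_maxPow_zero, zero_mem]

variable (L)

/-- The Iwahori subgroup `I_L = [[𝒪ˣ, 𝒪], [𝔭, 𝒪ˣ]]` of `GL₂(L)`: the unit group of the chain order
`[[𝒪, 𝒪], [𝔭, 𝒪]]`. -/
def iwahori : Subgroup (GL (Fin 2) L) where
  carrier := {g | (g : Matrix (Fin 2) (Fin 2) L) ∈ chainPow L 0 ∧
    ((g⁻¹ : GL (Fin 2) L) : Matrix (Fin 2) (Fin 2) L) ∈ chainPow L 0}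
  one_mem' := by
    rw [Set.mem_ofPred_eq, inv_one]
    exact ⟨one_mem_chainPow_zero, one_mem_chainPow_zero⟩
  mul_mem' := by
    rintro g h ⟨hg, hg'⟩ ⟨hh, hh'⟩
    refine ⟨?_, ?_⟩
    · exact mul_mem_chainPow (Or.inl ⟨rfl, rfl⟩) hg hh
    · rw [mul_inv_rev]
      exact mul_mem_chainPow (Or.inl ⟨rfl, rfl⟩) hh' hg'
  inv_mem' := by
    rintro g ⟨hg, hg'⟩
    refine ⟨hg', ?_⟩
    rwa [inv_inv]

/-- The subgroup `I_L ^ k` of `I_L`: those `g` for which `g - 1` has entries in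
`[[𝔭^⌊(k+1)/2⌋, 𝔭^⌊k/2⌋], [𝔭^(⌊k/2⌋+1), 𝔭^⌊(k+1)/2⌋]]`. -/
def iwahoriLevel (k : ℕ) : Subgroup (GL (Fin 2) L) where
  carrier := {g | g ∈ iwahori L ∧ (g : Matrix (Fin 2) (Fin 2) L) - 1 ∈ chainPow L k}
  one_mem' := ⟨one_mem _, by simp⟩
  mul_mem' := by
    rintro g h ⟨hg, hg'⟩ ⟨hh, hh'⟩
    refine ⟨mul_mem hg hh, ?_⟩
    have e : ((g * h : GL (Fin 2) L) : Matrix (Fin 2) (Fin 2) L) - 1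
        = (g - 1 : Matrix (Fin 2) (Fin 2) L) * h + (h - 1) := by
      rw [Units.val_mul]; noncomm_ring
    rw [e]
    exact add_mem (mul_mem_chainPow (Or.inr ⟨rfl, rfl⟩) hg' hh.1) hh'
  inv_mem' := by
    rintro g ⟨hg, hg'⟩
    refine ⟨inv_mem hg, ?_⟩
    have e : ((g⁻¹ : GL (Fin 2) L) : Matrix (Fin 2) (Fin 2) L) - 1
        = -(((g⁻¹ : GL (Fin 2) L) : Matrix (Fin 2) (Fin 2) L) * (g - 1)) := by
      rw [mul_sub, Units.inv_mul]; simp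
    rw [e]
    exact neg_mem (mul_mem_chainPow (Or.inl ⟨rfl, rfl⟩) hg.2 hg')

/-- `Z(L) I_L`, with `Z(L)` the centre of `GL₂(L)`. -/
def centerIwahori : Subgroup (GL (Fin 2) L) :=
  Subgroup.center (GL (Fin 2) L) ⊔ iwahori L

theorem conj_center_mul {G : Type*} [Group G] {z : G} (hz : z ∈ Subgroup.center G) (i h : G) :
    z * i * h * (z * i)⁻¹ = i * h * i⁻¹ := by
  have := Subgroup.mem_center_iff.1 hz (i * h * i⁻¹)
  calc z * i * h * (z * i)⁻¹ = z * (i * h * i⁻¹) * z⁻¹ := by group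
    _ = i * h * i⁻¹ := by rw [← this]; group

variable {L} in
theorem mem_iwahoriLevel {k : ℕ} {g : GL (Fin 2) L} : g ∈ iwahoriLevel L k ↔
    g ∈ iwahori L ∧ (g : Matrix (Fin 2) (Fin 2) L) - 1 ∈ chainPow L k := Iff.rfl

variable {L} in
theorem conj_mem_iwahoriLevel {k : ℕ} {g h : GL (Fin 2) L} (hg : g ∈ centerIwahori L)
    (hh : h ∈ iwahoriLevel L k) : g * h * g⁻¹ ∈ iwahoriLevel L k := by
  rw [centerIwahori, Subgroup.mem_sup_of_normal_left] at hg
  obtain ⟨z, hz, i, hi, hzi⟩ := hg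
  rw [← hzi, conj_center_mul hz, mem_iwahoriLevel]
  refine ⟨mul_mem (mul_mem hi hh.1) (inv_mem hi), ?_⟩
  have e : ((i * h * i⁻¹ : GL (Fin 2) L) : Matrix (Fin 2) (Fin 2) L) - 1
      = (i : Matrix (Fin 2) (Fin 2) L) * ((h : Matrix (Fin 2) (Fin 2) L) - 1)
        * ((i⁻¹ : GL (Fin 2) L) : Matrix (Fin 2) (Fin 2) L) := by
    rw [mul_sub, sub_mul, mul_one, Units.mul_inv, Units.val_mul, Units.val_mul]
  rw [e]
  have h1 : (i : Matrix (Fin 2) (Fin 2) L) * ((h : Matrix (Fin 2) (Fin 2) L) - 1) ∈ chainPow L k :=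
    mul_mem_chainPow (Or.inl ⟨rfl, rfl⟩) hi.1 hh.2
  exact mul_mem_chainPow (Or.inr ⟨rfl, rfl⟩) h1 hi.2

instance (k : ℕ) : ((iwahoriLevel L k).subgroupOf (centerIwahori L)).Normal where
  conj_mem _ hh g := conj_mem_iwahoriLevel g.2 hh

/-- The group `Z(L) I_L / I_L ^ (2m+1)`. -/
abbrev LevelQuotient (m : ℕ) : Type _ :=
  centerIwahori L ⧸ (iwahoriLevel L (2 * m + 1)).subgroupOf (centerIwahori L)

/-- The coset space `GL₂(L) / I_L ^ (2m+1)`. -/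
def CosetSpace (m : ℕ) : Type _ := GL (Fin 2) L ⧸ iwahoriLevel L (2 * m + 1)

variable {L} in
/-- The coset `g I_L ^ (2m+1)`. -/
def CosetSpace.mk (m : ℕ) (g : GL (Fin 2) L) : CosetSpace L m :=
  (QuotientGroup.mk g : GL (Fin 2) L ⧸ iwahoriLevel L (2 * m + 1))

variable {L} in
theorem CosetSpace.mk_eq {m : ℕ} {g h : GL (Fin 2) L} :
    CosetSpace.mk m g = CosetSpace.mk m h ↔ g⁻¹ * h ∈ iwahoriLevel L (2 * m + 1) :=
  QuotientGroup.eq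

variable {L} in
theorem CosetSpace.mk_surjective {m : ℕ} (x : CosetSpace L m) : ∃ g, CosetSpace.mk m g = x :=
  Quotient.inductionOn' x fun g => ⟨g, rfl⟩

/-- Right multiplication `(g I_L ^ (2m+1)) · i = g i I_L ^ (2m+1)` for `i ∈ Z(L) I_L / I_L ^ (2m+1)`,
which makes sense because `I_L ^ (2m+1)` is normalized by `Z(L) I_L`. -/
def rightMul (m : ℕ) (i : LevelQuotient L m) (x : CosetSpace L m) : CosetSpace L m :=
  Quotient.liftOn₂' i x (fun i g => CosetSpace.mk m (g * (i : GL (Fin 2) L))) (by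
    intro i g i' g' hi hg
    rw [QuotientGroup.leftRel_apply] at hi hg
    rw [CosetSpace.mk_eq]
    have h1 : ((i : GL (Fin 2) L))⁻¹ * i' ∈ iwahoriLevel L (2 * m + 1) := hi
    have h2 := conj_mem_iwahoriLevel (inv_mem i.2) hg
    have h3 := mul_mem h2 h1
    convert h3 using 1
    group)

instance (m : ℕ) : MulAction (LevelQuotient L m)ᵐᵒᵖ (CosetSpace L m) where
  smul i x := rightMul L m i.unop x
  one_smul x := by
    obtain ⟨g, rfl⟩ := x.mk_surjective
    change CosetSpace.mk m (g * ((1 : centerIwahori L) : GL (Fin 2) L)) = _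
    simp
  mul_smul i j x := by
    obtain ⟨g, rfl⟩ := x.mk_surjective
    induction i using MulOpposite.rec' with | _ i =>
    induction j using MulOpposite.rec' with | _ j =>
    induction i using QuotientGroup.induction_on with | _ i =>
    induction j using QuotientGroup.induction_on with | _ j =>
    change CosetSpace.mk m (g * ((j * i : centerIwahori L) : GL (Fin 2) L)) =
      CosetSpace.mk m (g * (j : GL (Fin 2) L) * (i : GL (Fin 2) L))
    simp [mul_assoc]

theorem op_smul_mk (m : ℕ) (i : centerIwahori L) (g : GL (Fin 2) L) :
    MulOpposite.op (QuotientGroup.mk i : LevelQuotient L m) • CosetSpace.mk m g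
      = CosetSpace.mk m (g * (i : GL (Fin 2) L)) := rfl

/-- A subgroup of `Z(L) I_L / I_L ^ (2m+1)` acts on the coset space by right multiplication. -/
instance (m : ℕ) (Γ : Subgroup (LevelQuotient L m)) : MulAction (Γ)ᵐᵒᵖ (CosetSpace L m) :=
  MulAction.compHom _ (MonoidHom.op Γ.subtype)

end Local

/-! ### Matrices -/

section Matrices

variable {E : Type*} [Field E]

/-- The diagonal matrix `diag(x, y)`. -/
def diag (x y : Eˣ) : GL (Fin 2) E where
  val := !![(x : E), 0; 0, (y : E)]
  inv := !![((x⁻¹ : Eˣ) : E), 0; 0, ((y⁻¹ : Eˣ) : E)]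
  val_inv := by simp [Matrix.one_fin_two]
  inv_val := by simp [Matrix.one_fin_two]

/-- The antidiagonal matrix `[[0, x], [y, 0]]`. -/
def antidiag (x y : Eˣ) : GL (Fin 2) E where
  val := !![0, (x : E); (y : E), 0]
  inv := !![0, ((y⁻¹ : Eˣ) : E); ((x⁻¹ : Eˣ) : E), 0]
  val_inv := by simp [Matrix.one_fin_two]
  inv_val := by simp [Matrix.one_fin_two]

/-- The lower triangular unipotent matrix `e₋(a) = [[1, 0], [a, 1]]`. -/
def lower (a : E) : GL (Fin 2) E where
  val := !![1, 0; a, 1]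
  inv := !![1, 0; -a, 1]
  val_inv := by simp [Matrix.one_fin_two]
  inv_val := by simp [Matrix.one_fin_two]

end Matrices

/-! ### The extended affine Deligne-Lusztig variety -/

section Variety

variable {F E : Type*} [Field F] [Field E] [Algebra F E]

/-- `τ` applied to the entries of an element of `GL₂(E)`. -/
def galGL (τ : E ≃ₐ[F] E) : GL (Fin 2) E →* GL (Fin 2) E :=
  Matrix.GeneralLinearGroup.map (τ : E →+* E)

/-- The inclusion `GL₂(F) → GL₂(E)`. -/
def baseGL (F E : Type*) [Field F] [Field E] [Algebra F E] : GL (Fin 2) F →* GL (Fin 2) E :=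
  Matrix.GeneralLinearGroup.map (algebraMap F E)

/-- `τ` on `Eˣ`. -/
def galUnit (τ : E ≃ₐ[F] E) : Eˣ →* Eˣ := Units.map (τ : E →* E)

/-- `ε = τ(π) / π`. -/
def eps (τ : E ≃ₐ[F] E) (π : Eˣ) : Eˣ := galUnit τ π / π

/-- `ẇ = [[0, π^(-n)], [π^n, 0]] · diag(ε^⌊n/2⌋, ε^(-⌊(n+1)/2⌋))`. -/
def wDot (τ : E ≃ₐ[F] E) (π : Eˣ) (n : ℕ) : GL (Fin 2) E :=
  antidiag (π ^ (-(n : ℤ))) (π ^ n) *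
    diag (eps τ π ^ (n / 2)) (eps τ π ^ (-(((n + 1) / 2 : ℕ) : ℤ)))

/-- `v̇ = [[0, π^(-(⌊(d+1)/2⌋ + ⌊(n+1)/2⌋))], [π^(⌊(d+1)/2⌋ + ⌊n/2⌋), 0]]`. -/
def vDot (π : Eˣ) (n d : ℕ) : GL (Fin 2) E :=
  antidiag (π ^ (-(((d + 1) / 2 + (n + 1) / 2 : ℕ) : ℤ))) (π ^ ((d + 1) / 2 + n / 2))

theorem galGL_baseGL (τ : E ≃ₐ[F] E) (g : GL (Fin 2) F) :
    galGL τ (baseGL F E g) = baseGL F E g := by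
  ext i j
  exact τ.commutes _

variable [ValuativeRel E]

/-- The double coset `I_E^(2m+1) ẇ I_E^(2m+1)`. -/
def doubleCosetW (τ : E ≃ₐ[F] E) (π : Eˣ) (n m : ℕ) : Set (GL (Fin 2) E) :=
  {g | ∃ j ∈ iwahoriLevel E (2 * m + 1), ∃ j' ∈ iwahoriLevel E (2 * m + 1),
    g = j * wDot τ π n * j'}

/-- The stabilizer in `Z(E) I_E` of the set `S = I_E^(2m+1) ẇ I_E^(2m+1)` under `τ`-conjugation:
the `i` with `i⁻¹ S τ(i) = S`. -/
def preGamma (τ : E ≃ₐ[F] E) (π : Eˣ) (n m : ℕ) : Subgroup (centerIwahori E) where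
  carrier := {i | ∀ g : GL (Fin 2) E, g ∈ doubleCosetW τ π n m ↔
    (i : GL (Fin 2) E)⁻¹ * g * galGL τ i ∈ doubleCosetW τ π n m}
  one_mem' := by intro g; simp
  mul_mem' := by
    intro i j hi hj g
    rw [hi g, hj _]
    simp [mul_assoc]
  inv_mem' := by
    intro i hi g
    have e : (i : GL (Fin 2) E)⁻¹ * (((i⁻¹ : centerIwahori E) : GL (Fin 2) E)⁻¹ * g *
        galGL τ ((i⁻¹ : centerIwahori E) : GL (Fin 2) E)) * galGL τ i = g := by
      simp [mul_assoc]
    rw [hi (_ * g * _), e]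

/-- The group `Γ̃ ⊆ Z(E) I_E / I_E^(2m+1)`: the `τ`-stabilizer of `I_E^(2m+1) ẇ I_E^(2m+1)`. -/
def GammaTilde (τ : E ≃ₐ[F] E) (π : Eˣ) (n m : ℕ) : Subgroup (LevelQuotient E m) :=
  (preGamma τ π n m).map (QuotientGroup.mk' _)

/-- The action of `GL₂(F)` on `GL₂(E) / I_E^(2m+1)` by left multiplication. -/
instance (m : ℕ) : MulAction (GL (Fin 2) F) (CosetSpace E m) where
  smul g x := Quotient.liftOn' x (fun h => CosetSpace.mk m (baseGL F E g * h)) (by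
    intro a b hab
    rw [QuotientGroup.leftRel_apply] at hab
    rw [CosetSpace.mk_eq]
    convert hab using 1
    group)
  one_smul x := by
    obtain ⟨g, rfl⟩ := x.mk_surjective
    change CosetSpace.mk m _ = CosetSpace.mk m _
    simp
  mul_smul a b x := by
    obtain ⟨g, rfl⟩ := x.mk_surjective
    change CosetSpace.mk m _ = CosetSpace.mk m _
    simp [mul_assoc]

theorem smul_mk (m : ℕ) (g : GL (Fin 2) F) (h : GL (Fin 2) E) :
    g • CosetSpace.mk m h = CosetSpace.mk m (baseGL F E g * h) := rfl

/-- The left action of `GL₂(F)` commutes with the right action of `Z(E) I_E / I_E^(2m+1)`. -/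
instance (m : ℕ) (Γ : Subgroup (LevelQuotient E m)) :
    SMulCommClass (GL (Fin 2) F) (Γ)ᵐᵒᵖ (CosetSpace E m) where
  smul_comm a γ x := by
    obtain ⟨g, rfl⟩ := x.mk_surjective
    induction γ using MulOpposite.rec' with | _ γ =>
    obtain ⟨γ, hγ⟩ := γ
    induction γ using QuotientGroup.induction_on with | _ i =>
    change CosetSpace.mk m (baseGL F E a * (g * (i : GL (Fin 2) E))) =
      CosetSpace.mk m (baseGL F E a * g * (i : GL (Fin 2) E))
    rw [mul_assoc]

/-- The extended affine Deligne-Lusztig variety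
`X_ẇ^m(1) = {g I_E^(2m+1) : g⁻¹ τ(g) ∈ I_E^(2m+1) ẇ I_E^(2m+1)}`, with the right action of `Γ̃`. -/
def variety (τ : E ≃ₐ[F] E) (π : Eˣ) (n m : ℕ) :
    SubMulAction (GammaTilde τ π n m)ᵐᵒᵖ (CosetSpace E m) where
  carrier := {x | ∃ g : GL (Fin 2) E, x = CosetSpace.mk m g ∧ g⁻¹ * galGL τ g ∈ doubleCosetW τ π n m}
  smul_mem' := by
    rintro γ _ ⟨g, rfl, hg⟩
    induction γ using MulOpposite.rec' with | _ γ =>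
    obtain ⟨_, i, hi, rfl⟩ := γ
    refine ⟨g * (i : GL (Fin 2) E), rfl, ?_⟩
    have := (hi _).1 hg
    simpa [mul_assoc] using this

/-- `X_ẇ^m(1)` is stable under `GL₂(F)`. -/
theorem smul_mem_variety (τ : E ≃ₐ[F] E) (π : Eˣ) (n m : ℕ) (a : GL (Fin 2) F) :
    ∀ x ∈ variety τ π n m, a • x ∈ variety τ π n m := by
  rintro _ ⟨g, rfl, hg⟩
  refine ⟨baseGL F E a * g, rfl, ?_⟩
  rw [map_mul, galGL_baseGL]
  simpa [mul_assoc] using hg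

/-- `X_ẇ^m(1)_{P_{1/2}}`: the points of `X_ẇ^m(1)` lying over the locus `a₁ ≠ 0` of the Schubert cell
`C_v = {e₋(a) v̇ I_E : a ∈ 𝔭_E}`, where `a = a₁ π + a₂ π² + ⋯`. -/
def varietyHalf (τ : E ≃ₐ[F] E) (π : Eˣ) (n m d : ℕ) : Set (CosetSpace E m) :=
  {x | x ∈ variety τ π n m ∧ ∃ a : E, HasOrd a 1 ∧ ∃ k ∈ iwahori E,
    x = CosetSpace.mk m (lower a * vDot π n d * k)}

/-- `X̃_ẇ^m(1)_{P_{1/2}}`: the smallest `Γ̃`-stable subset containing `X_ẇ^m(1)_{P_{1/2}}`. -/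
def varietyTilde (τ : E ≃ₐ[F] E) (π : Eˣ) (n m d : ℕ) :
    SubMulAction (GammaTilde τ π n m)ᵐᵒᵖ (CosetSpace E m) where
  carrier := {x | ∃ y ∈ varietyHalf τ π n m d, ∃ γ : GammaTilde τ π n m, x = MulOpposite.op γ • y}
  smul_mem' := by
    rintro γ _ ⟨y, hy, γ', rfl⟩
    exact ⟨y, hy, γ' * γ.unop, by rw [smul_smul]; rfl⟩

/-- The group `ι(Eˣ) I_F`. -/
def torusIwahori [ValuativeRel F] (ι : E →ₐ[F] Matrix (Fin 2) (Fin 2) F) :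
    Subgroup (GL (Fin 2) F) :=
  (Units.map (ι : E →* Matrix (Fin 2) (Fin 2) F)).range ⊔ iwahori F

variable {K : Type*} [Field K]

/-- The `GL₂(F)`-representation `R_θ̃ = H⁰_c(X_ẇ^m(1), K)[θ̃]`. -/
noncomputable def repR {τ : E ≃ₐ[F] E} {π : Eˣ} {n m : ℕ} (θt : GammaTilde τ π n m →* Kˣ) :
    Representation K (GL (Fin 2) F) (IsotypicPart K (variety τ π n m) θt) :=
  isotypicRep K (variety τ π n m) (smul_mem_variety τ π n m) θt

/-- The space `V_θ̃ = H⁰_c(X̃_ẇ^m(1)_{P_{1/2}}, K)[θ̃]`. -/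
abbrev SpaceV {τ : E ≃ₐ[F] E} {π : Eˣ} {n m : ℕ} (d : ℕ) (θt : GammaTilde τ π n m →* Kˣ) : Type _ :=
  IsotypicPart K (varietyTilde τ π n m d) θt

/-- The representation `Ξ_θ̃` of `ι(Eˣ) I_F` in `V_θ̃`; here `h` says that
`X̃_ẇ^m(1)_{P_{1/2}}` is stable under `ι(Eˣ) I_F`. -/
noncomputable def repXi [ValuativeRel F] (ι : E →ₐ[F] Matrix (Fin 2) (Fin 2) F)
    {τ : E ≃ₐ[F] E} {π : Eˣ} {n m : ℕ} (d : ℕ) (θt : GammaTilde τ π n m →* Kˣ)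
    (h : ∀ g : torusIwahori ι, ∀ x ∈ varietyTilde τ π n m d, g • x ∈ varietyTilde τ π n m d) :
    Representation K (torusIwahori ι) (SpaceV d θt) :=
  isotypicRep K (varietyTilde τ π n m d) h θt

/-- `ω` is the central character of the (non-zero) representation `ρ` of `GL₂(F)`. -/
def IsCentralCharacter {V : Type*} [AddCommGroup V] [Module K V]
    (ρ : Representation K (GL (Fin 2) F) V) (ω : Fˣ →* Kˣ) : Prop :=
  Nontrivial V ∧ ∀ (z : Fˣ) (v : V),
    ρ (Matrix.GeneralLinearGroup.scalar (Fin 2) z) v = (ω z : K) • v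

end Variety

end WildGL2

/-! Everything reduces to the combinatorics of a free right action of `Γ̃`. Since `J` is normalized
by `Z(E) I_E`, the set `i⁻¹ J ẇ J τ(i)` is again a single double coset of `J`. Hence two points of
`X` with the same image in `GL₂(E) / Z(E) I_E` differ by an element of `Γ̃` (`exists_smul_eq`), and
this element is unique (`gammaTilde_free`). For a free action the isotypic part has a basis indexed
by the orbits (`isotypicEquiv`), so `R_θ̃` is non-zero as soon as `X` has a point, and `dim V_θ̃` is
the number of `Γ̃`-orbits on `X̃`.

The arithmetic input is that `ord τ(a) - a = d + 1` whenever `ord a = 1`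
(`wildQuadratic_of_minpoly`). Because of it the equation `τ(g) = g ẇ` has an explicit solution `g =
e₋(a) v̇ k` with `k ∈ I_E` for each such `a` (`WildQuadratic.exists_lang`). So every point of the
locus `ord a = 1` of the Schubert cell lifts to `X`, and the orbits on `X̃` are exactly the points
of that locus. Two values of `a` give the same point iff they agree modulo `𝔭 ^ (n + d + 1)`;
dividing by `π` leaves the units of `𝒪_E / 𝔭_E ^ (n + d)`, of which there are `(q - 1) q ^ (n + d -
1)`.

On the cell `GL₂(F)` acts by Möbius transformations of `a`, and `ι(Eˣ) I_F` preserves the condition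
`ord a = 1`; this gives the stability of `X̃`. A scalar from `F` acts as right multiplication by
some `diag(t, τ(t))`, whence the central character.

For triviality on `I_F ^ (m + d + 1)`: moved to the right of a lifted point, such an element
becomes, modulo `J`, an upper unipotent matrix with entry in `𝔭 ^ (n + d)`. Every matrix of this
kind is congruent to a commutator of `diag(π, τ(π))` with an element of `Γ̃` of the shape `[[1, y],
[ϖ ^ n τ(y), 1]]` (`WildQuadratic.exists_commutator`), and a character of `Γ̃` kills commutators. -/

namespace WildGL2


/-! ### The fractional ideals of a local field -/

section FractionalIdeals

variable {L : Type*} [Field L] [ValuativeRel L]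

open ValuativeRel

/-- The elements whose valuation is at most that of `π ^ k`. -/
noncomputable def fracPow (π : L) (k : ℤ) : AddSubgroup L where
  carrier := {x | valuation L x ≤ valuation L π ^ k}
  zero_mem' := by simp
  add_mem' := fun hx hy => (valuation L).map_add_le hx hy
  neg_mem' := fun {x} hx => by simpa [Valuation.map_neg] using hx

/-- `x` has the valuation of `π ^ k`. -/
def OrdEq (π : L) (k : ℤ) (x : L) : Prop := valuation L x = valuation L π ^ k

/-- `π` is a uniformizer. -/
structure IsUnif (π : L) : Prop where
  pos : 0 < valuation L π
  lt_one : valuation L π < 1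
  maximal : ∀ x : L, valuation L x < 1 → valuation L x ≤ valuation L π

theorem mem_fracPow {π x : L} {k : ℤ} : x ∈ fracPow π k ↔ valuation L x ≤ valuation L π ^ k :=
  Iff.rfl

theorem mem_maxIdeal_iff {x : 𝒪[L]} : x ∈ 𝓂[L] ↔ valuation L (x : L) < 1 := by
  rw [IsLocalRing.mem_maximalIdeal, mem_nonunits_iff]
  exact Valuation.Integer.not_isUnit_iff_valuation_lt_one

theorem isUnif_of_maxIdeal_eq {π : L} (h1 : valuation L π < 1) (h0 : π ≠ 0)
    (hs : 𝓂[L] = Ideal.span {(⟨π, h1.le⟩ : 𝒪[L])}) : IsUnif π := by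
  refine ⟨by simpa [zero_lt_iff] using h0, h1, fun x hx => ?_⟩
  have hm : (⟨x, hx.le⟩ : 𝒪[L]) ∈ 𝓂[L] := mem_maxIdeal_iff.2 hx
  rw [hs, Ideal.mem_span_singleton] at hm
  exact Valuation.Integers.le_of_dvd (Valuation.integer.integers _) hm

theorem IsUnif.maxIdeal_eq {π : L} (h : IsUnif π) :
    𝓂[L] = Ideal.span {(⟨π, h.lt_one.le⟩ : 𝒪[L])} := by
  ext x
  rw [mem_maxIdeal_iff, Ideal.mem_span_singleton,
    ← (Valuation.integer.integers (valuation L)).le_iff_dvd]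
  exact ⟨fun hx => h.maximal _ hx, fun hx => lt_of_le_of_lt hx h.lt_one⟩

/-- Passes from powers of the maximal ideal to inequalities of valuations. The latter make sense for
negative exponents, which the entries of `v̇` and `ẇ` require. -/
theorem IsUnif.mem_maxPow_iff {π : L} (h : IsUnif π) {x : L} {k : ℕ} :
    x ∈ maxPow L k ↔ x ∈ fracPow π k := by
  have key : ∀ y : 𝒪[L], y ∈ 𝓂[L] ^ k ↔ valuation L (y : L) ≤ valuation L π ^ k := by
    intro y
    rw [h.maxIdeal_eq, Ideal.span_singleton_pow, Ideal.mem_span_singleton,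
      ← (Valuation.integer.integers (valuation L)).le_iff_dvd, map_pow, map_pow]
    rfl
  rw [mem_fracPow, zpow_natCast]
  constructor
  · rintro ⟨y, hy, rfl⟩
    exact (key y).1 hy
  · intro hx
    have h1 : valuation L x ≤ 1 := hx.trans (pow_le_one₀ zero_le h.lt_one.le)
    exact ⟨⟨x, h1⟩, (key _).2 hx, rfl⟩

theorem IsUnif.fracPow_anti {π : L} (h : IsUnif π) {i j : ℤ} (hij : i ≤ j) :
    fracPow π j ≤ fracPow π i := fun _ hx =>
  mem_fracPow.2 <| (mem_fracPow.1 hx).trans (zpow_le_zpow_right_of_le_one₀ h.pos h.lt_one.le hij)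

theorem IsUnif.mul_mem {π : L} (h : IsUnif π) {i j k : ℤ} {x y : L} (hx : x ∈ fracPow π i)
    (hy : y ∈ fracPow π j) (hk : k ≤ i + j) : x * y ∈ fracPow π k := by
  refine h.fracPow_anti hk ?_
  rw [mem_fracPow, map_mul, zpow_add₀ h.pos.ne']
  exact mul_le_mul' hx hy

theorem OrdEq.mem {π x : L} {k : ℤ} (h : OrdEq π k x) : x ∈ fracPow π k := le_of_eq h

theorem OrdEq.mul {π x y : L} (h : IsUnif π) {i j : ℤ} (hx : OrdEq π i x) (hy : OrdEq π j y) :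
    OrdEq π (i + j) (x * y) := by
  rw [OrdEq, map_mul, hx, hy, zpow_add₀ h.pos.ne']

theorem OrdEq.inv {π x : L} {i : ℤ} (hx : OrdEq π i x) : OrdEq π (-i) x⁻¹ := by
  rw [OrdEq, map_inv₀, hx, zpow_neg]

theorem OrdEq.neg {π x : L} {i : ℤ} (hx : OrdEq π i x) : OrdEq π i (-x) := by
  rw [OrdEq, Valuation.map_neg, hx]

theorem OrdEq.div {π x y : L} (h : IsUnif π) {i j : ℤ} (hx : OrdEq π i x) (hy : OrdEq π j y) :
    OrdEq π (i - j) (x / y) := by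
  rw [div_eq_mul_inv, sub_eq_add_neg]
  exact hx.mul h hy.inv

theorem ordEq_zpow (π : L) (k : ℤ) : OrdEq π k (π ^ k) := map_zpow₀ _ _ _

theorem ordEq_self (π : L) : OrdEq π 1 π := by rw [OrdEq, zpow_one]

theorem ordEq_one (π : L) : OrdEq π 0 1 := by rw [OrdEq, map_one, zpow_zero]

theorem OrdEq.pow {π x : L} {i : ℤ} (hx : OrdEq π i x) (k : ℕ) : OrdEq π (i * k) (x ^ k) := by
  rw [OrdEq, map_pow, hx, zpow_mul, zpow_natCast]

theorem OrdEq.mem_iff {π x : L} (h : IsUnif π) {i j : ℤ} (hx : OrdEq π i x) :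
    x ∈ fracPow π j ↔ j ≤ i := by
  rw [mem_fracPow, hx, zpow_le_zpow_iff_right_of_lt_one₀ h.pos h.lt_one]

theorem OrdEq.mem_of_le {π x : L} (h : IsUnif π) {i j : ℤ} (hx : OrdEq π i x) (hij : j ≤ i) :
    x ∈ fracPow π j := (hx.mem_iff h).2 hij

theorem OrdEq.unique {π x : L} (h : IsUnif π) {i j : ℤ} (hx : OrdEq π i x) (hx' : OrdEq π j x) :
    i = j :=
  le_antisymm ((hx'.mem_iff h).1 hx.mem) ((hx.mem_iff h).1 hx'.mem)

theorem OrdEq.ne_zero {π x : L} (h : IsUnif π) {i : ℤ} (hx : OrdEq π i x) : x ≠ 0 := by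
  rintro rfl
  rw [OrdEq, map_zero] at hx
  exact (zpow_pos h.pos i).ne hx

theorem OrdEq.add {π x y : L} (h : IsUnif π) {i j : ℤ} (hx : OrdEq π i x)
    (hy : y ∈ fracPow π j) (hij : i < j) : OrdEq π i (x + y) := by
  rw [OrdEq, Valuation.map_add_eq_of_lt_left, hx]
  rw [hx]
  exact lt_of_le_of_lt hy (zpow_lt_zpow_right_of_lt_one₀ h.pos h.lt_one hij)

theorem OrdEq.sub {π x y : L} (h : IsUnif π) {i j : ℤ} (hx : OrdEq π i x)
    (hy : y ∈ fracPow π j) (hij : i < j) : OrdEq π i (x - y) := by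
  rw [sub_eq_add_neg]
  exact hx.add h (neg_mem hy) hij

theorem IsUnif.ordEq_iff {π x : L} (h : IsUnif π) {k : ℤ} :
    OrdEq π k x ↔ x ∈ fracPow π k ∧ x ∉ fracPow π (k + 1) := by
  constructor
  · intro hx
    exact ⟨hx.mem, fun h' => by have := (hx.mem_iff h).1 h'; omega⟩
  · rintro ⟨h1, h2⟩
    refine le_antisymm h1 (not_lt.1 fun hlt => h2 ?_)
    -- If `x` were strictly smaller than `π ^ k`, then `x π ^ (-k)` would have valuation below `1`,
    -- hence at most that of `π`, as no value lies strictly between.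
    have hk : (0 : ValueGroupWithZero L) < valuation L π ^ k := zpow_pos h.pos _
    have : valuation L (x * π ^ (-k)) < 1 := by
      rw [map_mul, map_zpow₀, zpow_neg]
      rwa [← div_eq_mul_inv, div_lt_one₀ hk]
    have h3 := h.maximal _ this
    rw [mem_fracPow, zpow_add₀ h.pos.ne', zpow_one]
    rw [map_mul, map_zpow₀, zpow_neg, ← div_eq_mul_inv, div_le_iff₀ hk] at h3
    rwa [mul_comm]

theorem IsUnif.hasOrd_iff {π x : L} (h : IsUnif π) {k : ℕ} : HasOrd x k ↔ OrdEq π k x := by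
  rw [HasOrd, h.mem_maxPow_iff, h.mem_maxPow_iff, h.ordEq_iff]
  push_cast
  rfl

end FractionalIdeals

/-! ### Uniformizers and orders in a non-archimedean local field -/

section LocalField

variable {L : Type*} [Field L] [ValuativeRel L] [TopologicalSpace L] [IsNonarchimedeanLocalField L]

open ValuativeRel

theorem exists_isUnif : ∃ π : L, IsUnif π := by
  obtain ⟨p, hp⟩ := IsDiscreteValuationRing.exists_irreducible 𝒪[L]
  have hm := hp.maximalIdeal_eq
  have h1 : valuation L (p : L) < 1 :=
    mem_maxIdeal_iff.1 (by rw [hm]; exact Ideal.mem_span_singleton_self p)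
  exact ⟨p, isUnif_of_maxIdeal_eq h1 (fun h => hp.ne_zero (Subtype.ext h)) hm⟩

/-- Measured against any uniformizer `p`, an element of order `1` has the valuation of `p`, and
being a uniformizer depends on the valuation only. -/
theorem HasOrd.isUnif {π : L} (hπ : HasOrd π 1) : IsUnif π := by
  obtain ⟨p, hp⟩ := exists_isUnif (L := L)
  have h := hp.hasOrd_iff.1 hπ
  rw [OrdEq, Nat.cast_one, zpow_one] at h
  exact ⟨h ▸ hp.pos, h ▸ hp.lt_one, h ▸ hp.maximal⟩

theorem IsUnif.exists_ordEq {π : L} (h : IsUnif π) {x : L} (hx : x ≠ 0) : ∃ k : ℤ, OrdEq π k x := by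
  have int : ∀ y : 𝒪[L], y ≠ 0 → ∃ k : ℤ, OrdEq π k (y : L) := by
    intro y hy
    have hirr : Irreducible (⟨π, h.lt_one.le⟩ : 𝒪[L]) := by
      rw [IsDiscreteValuationRing.irreducible_iff_uniformizer]
      exact h.maxIdeal_eq
    obtain ⟨k, u, hu⟩ := IsDiscreteValuationRing.eq_unit_mul_pow_irreducible hy hirr
    refine ⟨k, ?_⟩
    rw [OrdEq, hu]
    have hu1 : valuation L ((u : 𝒪[L]) : L) = 1 :=
      (Valuation.integer.integers (valuation L)).one_of_isUnit u.isUnit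
    simp [hu1]
  rcases le_total (valuation L x) 1 with h1 | h1
  · exact int ⟨x, h1⟩ (fun h0 => hx (congrArg Subtype.val h0))
  · have h2 : valuation L x⁻¹ ≤ 1 := by
      rw [map_inv₀]
      exact inv_le_one_of_one_le₀ h1
    obtain ⟨k, hk⟩ := int ⟨x⁻¹, h2⟩ (fun h0 => inv_ne_zero hx (congrArg Subtype.val h0))
    exact ⟨-k, by simpa using hk.inv⟩

end LocalField


/-! ### Isotypic parts for free actions -/

section FreeIsotypic

variable {K : Type*} [Field K] {Γ α : Type*} [Group Γ] [MulAction Γᵐᵒᵖ α]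
  {Y : SubMulAction Γᵐᵒᵖ α}

theorem isotypic_mk_smul (χ : Γ →* Kˣ) (γ : Γ) (y : Y) (c : K) :
    (isotypicRelations K Y χ).mkQ (Finsupp.single (MulOpposite.op γ • y) c) =
      (χ γ : K) • (isotypicRelations K Y χ).mkQ (Finsupp.single y c) := by
  rw [← map_smul, ← sub_eq_zero, ← map_sub, Submodule.mkQ_apply, Submodule.Quotient.mk_eq_zero]
  refine Submodule.subset_span ⟨γ, Finsupp.single y c, ?_⟩
  rw [Finsupp.lmapDomain_apply, Finsupp.mapDomain_single]

/-- If `Γ` acts freely on `Y` and `s` is a system of representatives of the orbits, then the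
`χ`-isotypic part has a basis indexed by the orbits. -/
noncomputable def isotypicEquiv (χ : Γ →* Kˣ) {I : Type*} (e : I × Γ ≃ Y)
    (he : ∀ i γ γ', e (i, γ * γ') = MulOpposite.op γ' • e (i, γ)) :
    IsotypicPart K Y χ ≃ₗ[K] (I →₀ K) := by
  -- The point `e (i, γ)` is sent to `χ γ` times the basis vector of its orbit `i`; this is
  -- compatible with the relations because `χ` is multiplicative.
  let f : (Y →₀ K) →ₗ[K] (I →₀ K) :=
    Finsupp.linearCombination K fun y => Finsupp.single (e.symm y).1 (χ (e.symm y).2 : K)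
  have hf : isotypicRelations K Y χ ≤ LinearMap.ker f := by
    rw [isotypicRelations, Submodule.span_le]
    rintro _ ⟨γ, φ, rfl⟩
    rw [SetLike.mem_coe, LinearMap.mem_ker, map_sub, map_smul, sub_eq_zero]
    have h : f ∘ₗ Finsupp.lmapDomain K K (fun x : Y => MulOpposite.op γ • x) = (χ γ : K) • f := by
      refine Finsupp.lhom_ext fun y c => ?_
      obtain ⟨⟨i, γ'⟩, rfl⟩ := e.surjective y
      simp only [LinearMap.comp_apply, Finsupp.lmapDomain_apply, Finsupp.mapDomain_single,
        LinearMap.smul_apply, f, Finsupp.linearCombination_single, ← he, Equiv.symm_apply_apply,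
        Finsupp.smul_single, smul_eq_mul, map_mul, Units.val_mul]
      congr 1
      ring
    exact LinearMap.congr_fun h φ
  -- The inverse sends the basis vector of an orbit to the class of its chosen representative.
  let b : (I →₀ K) →ₗ[K] IsotypicPart K Y χ :=
    (isotypicRelations K Y χ).mkQ ∘ₗ Finsupp.lmapDomain K K fun i => e (i, 1)
  refine LinearEquiv.ofLinearMap ((isotypicRelations K Y χ).liftQ f hf) b ?_ ?_
  · refine Finsupp.lhom_ext fun i c => ?_
    simp only [LinearMap.comp_apply, b, Finsupp.lmapDomain_apply, Finsupp.mapDomain_single,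
      Submodule.mkQ_apply, Submodule.liftQ_apply, f, Finsupp.linearCombination_single,
      Equiv.symm_apply_apply, Finsupp.smul_single, map_one, Units.val_one, smul_eq_mul, mul_one,
      LinearMap.id_apply]
  · refine Submodule.linearMap_qext _ (Finsupp.lhom_ext fun y c => ?_)
    obtain ⟨⟨i, γ⟩, rfl⟩ := e.surjective y
    simp only [LinearMap.comp_apply, b, Submodule.mkQ_apply, Submodule.liftQ_apply, f,
      Finsupp.linearCombination_single, Equiv.symm_apply_apply, Finsupp.smul_single,
      Finsupp.lmapDomain_apply, Finsupp.mapDomain_single, LinearMap.id_apply]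
    have h := isotypic_mk_smul χ γ (e (i, 1)) c
    rw [← he, one_mul, ← map_smul, Finsupp.smul_single, smul_eq_mul, Submodule.mkQ_apply,
      Submodule.mkQ_apply] at h
    rw [h, smul_eq_mul, mul_comm]

/-- The parametrization of a set with a free action by orbit representatives. -/
noncomputable def freeEquiv {I : Type*} (s : I → Y)
    (hs : ∀ y : Y, ∃ i, ∃ γ : Γ, y = MulOpposite.op γ • s i)
    (hi : ∀ i j, ∀ γ : Γ, s i = MulOpposite.op γ • s j → i = j)
    (hfree : ∀ (y : Y) (γ : Γ), MulOpposite.op γ • y = y → γ = 1) : I × Γ ≃ Y :=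
  Equiv.ofBijective (fun x => MulOpposite.op x.2 • s x.1) (by
    constructor
    · rintro ⟨i, γ⟩ ⟨j, γ'⟩ h
      have h' : MulOpposite.op γ • s i = MulOpposite.op γ' • s j := h
      have h1 : s i = MulOpposite.op (γ' * γ⁻¹) • s j := by
        rw [MulOpposite.op_mul, mul_smul, ← h', smul_smul, ← MulOpposite.op_mul, mul_inv_cancel,
          MulOpposite.op_one, one_smul]
      obtain rfl := hi _ _ _ h1
      have h2 := hfree _ _ h1.symm
      rw [mul_inv_eq_one] at h2
      rw [h2]
    · intro y
      obtain ⟨i, γ, h⟩ := hs y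
      exact ⟨(i, γ), h.symm⟩)

theorem freeEquiv_mul {I : Type*} (s : I → Y)
    (hs : ∀ y : Y, ∃ i, ∃ γ : Γ, y = MulOpposite.op γ • s i)
    (hi : ∀ i j, ∀ γ : Γ, s i = MulOpposite.op γ • s j → i = j)
    (hfree : ∀ (y : Y) (γ : Γ), MulOpposite.op γ • y = y → γ = 1) (i : I) (γ γ' : Γ) :
    freeEquiv s hs hi hfree (i, γ * γ') = MulOpposite.op γ' • freeEquiv s hs hi hfree (i, γ) := by
  change MulOpposite.op (γ * γ') • s i = MulOpposite.op γ' • MulOpposite.op γ • s i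
  rw [smul_smul, MulOpposite.op_mul]

/-- Each free orbit contributes one copy of `K`, whatever `χ` is. Representatives are chosen
arbitrarily. -/
theorem isotypicPart_nontrivial (χ : Γ →* Kˣ) [Nonempty Y]
    (hfree : ∀ (y : Y) (γ : Γ), MulOpposite.op γ • y = y → γ = 1) :
    Nontrivial (IsotypicPart K Y χ) := by
  let s : MulAction.orbitRel.Quotient Γᵐᵒᵖ Y → Y := Quotient.out
  have hs : ∀ y : Y, ∃ i, ∃ γ : Γ, y = MulOpposite.op γ • s i := by
    intro y
    have h : MulAction.orbitRel Γᵐᵒᵖ Y y (s (Quotient.mk (MulAction.orbitRel Γᵐᵒᵖ Y) y)) := 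
      (MulAction.orbitRel Γᵐᵒᵖ Y).symm (@Quotient.mk_out _ (MulAction.orbitRel Γᵐᵒᵖ Y) y)
    obtain ⟨γ, hγ⟩ := MulAction.orbitRel_apply.1 h
    exact ⟨_, γ.unop, hγ.symm⟩
  have hi : ∀ i j, ∀ γ : Γ, s i = MulOpposite.op γ • s j → i = j := by
    intro i j γ h
    rw [← Quotient.out_eq i, ← Quotient.out_eq j]
    exact Quotient.sound (MulAction.orbitRel_apply.2 ⟨_, h.symm⟩)
  have : Nonempty (MulAction.orbitRel.Quotient Γᵐᵒᵖ Y) :=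
    ⟨Quotient.mk (MulAction.orbitRel Γᵐᵒᵖ Y) (Classical.arbitrary Y)⟩
  exact (isotypicEquiv χ (freeEquiv s hs hi hfree) (freeEquiv_mul s hs hi hfree)).toEquiv.nontrivial

variable {H : Type*} [Group H] [MulAction H α] [SMulCommClass H Γᵐᵒᵖ α]

theorem isotypicRep_mk_single (hY : ∀ g : H, ∀ x ∈ Y, g • x ∈ Y) (χ : Γ →* Kˣ) (g : H) (y : Y)
    (c : K) :
    isotypicRep K Y hY χ g ((isotypicRelations K Y χ).mkQ (Finsupp.single y c)) =
      (isotypicRelations K Y χ).mkQ (Finsupp.single ⟨g • (y : α), hY g y y.2⟩ c) := by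
  have h : functionRep K Y hY g (Finsupp.single y c) =
      Finsupp.single ⟨g • (y : α), hY g y y.2⟩ c := by
    simp only [functionRep, MonoidHom.coe_mk, OneHom.coe_mk, Finsupp.lmapDomain_apply,
      Finsupp.mapDomain_single]
  rw [← h]
  rfl

/-- If `g` moves each point of `Y` by an element on which `χ` takes the value `c`, then `g` acts on
the `χ`-isotypic part as the scalar `c`. -/
theorem isotypicRep_eq_smul (hY : ∀ g : H, ∀ x ∈ Y, g • x ∈ Y) (χ : Γ →* Kˣ) (g : H) (c : K)
    (h : ∀ y ∈ Y, ∃ γ : Γ, g • y = MulOpposite.op γ • y ∧ (χ γ : K) = c) :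
    isotypicRep K Y hY χ g = c • LinearMap.id := by
  refine Submodule.linearMap_qext _ (Finsupp.lhom_ext fun y b => ?_)
  obtain ⟨γ, hγ, hc⟩ := h y y.2
  have h1 : (⟨g • (y : α), hY g y y.2⟩ : Y) = MulOpposite.op γ • y := Subtype.ext hγ
  rw [LinearMap.comp_apply, LinearMap.comp_apply, isotypicRep_mk_single, h1, isotypic_mk_smul, hc]
  rfl

end FreeIsotypic


/-! ### Wildly ramified quadratic extensions -/

section Extension

open ValuativeRel

variable {F E : Type*} [Field F] [ValuativeRel F] [Field E] [ValuativeRel E] [Algebra F E]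

/-- The ramified quadratic extension `E / F` with uniformizers `π`, `ϖ = π τ(π)`, in which `τ - 1`
shifts odd valuations by `d`. -/
structure WildQuadratic (τ : E ≃ₐ[F] E) (π : E) (ϖ : F) (d : ℕ) : Prop where
  unif : IsUnif π
  unif_base : IsUnif ϖ
  val_gal : ∀ x, valuation E (τ x) = valuation E x
  gal_gal : ∀ x, τ (τ x) = x
  norm : π * τ π = algebraMap F E ϖ
  mem_base : ∀ x k, algebraMap F E x ∈ fracPow π (2 * k) ↔ x ∈ fracPow ϖ k
  ord_base : ∀ x k, OrdEq ϖ k x → OrdEq π (2 * k) (algebraMap F E x)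
  exists_eq : ∀ e : E, ∃ u w : F, e = algebraMap F E u + algebraMap F E w * π
  ord_diff : ∀ a, OrdEq π 1 a → OrdEq π (d + 1) (τ a - a)
  card_residue : Nat.card 𝓀[E] = Nat.card 𝓀[F]

variable [ValuativeExtension F E]

theorem valuation_algebraMap_le {x y : F} :
    valuation E (algebraMap F E x) ≤ valuation E (algebraMap F E y) ↔
      valuation F x ≤ valuation F y := by
  rw [← (valuation E).vle_iff_le, ← (valuation F).vle_iff_le]
  exact ValuativeExtension.vle_iff_vle x y

variable {π : E} {ϖ : F}

theorem algebraMap_mem_fracPow (h : OrdEq π 2 (algebraMap F E ϖ)) {x : F} {k : ℤ} :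
    algebraMap F E x ∈ fracPow π (2 * k) ↔ x ∈ fracPow ϖ k := by
  rw [mem_fracPow, mem_fracPow, ← map_zpow₀ (valuation F), ← valuation_algebraMap_le (E := E),
    map_zpow₀, map_zpow₀, h, zpow_mul]

theorem algebraMap_ordEq (h : OrdEq π 2 (algebraMap F E ϖ)) {x : F} {k : ℤ} (hx : OrdEq ϖ k x) :
    OrdEq π (2 * k) (algebraMap F E x) := by
  rw [OrdEq, ← map_zpow₀] at hx
  have h1 : valuation E (algebraMap F E x) = valuation E (algebraMap F E (ϖ ^ k)) :=
    le_antisymm (valuation_algebraMap_le.2 hx.le) (valuation_algebraMap_le.2 hx.ge)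
  rw [OrdEq, h1, map_zpow₀, map_zpow₀, h, zpow_mul]

/-- The argument for Eisenstein polynomials, run twice: `Δ ∈ 𝔭_E` gives `ϖ = -(π² + Δ π) ∈ 𝔭_E²`;
since `Δ` is no larger than `ϖ`, also `Δ ∈ 𝔭_E²`, so that `π²` strictly dominates `Δ π`. -/
theorem ordEq_algebraMap_uniformizer (hπ : IsUnif π) {Δ : F}
    (hΔ : valuation F Δ ≤ valuation F ϖ) (hϖ : valuation F ϖ < 1)
    (hmin : π ^ 2 + algebraMap F E Δ * π + algebraMap F E ϖ = 0) :
    OrdEq π 2 (algebraMap F E ϖ) := by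
  have hP : algebraMap F E ϖ = -(π ^ 2 + algebraMap F E Δ * π) := by linear_combination hmin
  have h1 : valuation E (algebraMap F E Δ) ≤ valuation E (algebraMap F E ϖ) :=
    valuation_algebraMap_le.2 hΔ
  have h2 : valuation E (algebraMap F E ϖ) < 1 := by
    rw [← not_le] at hϖ ⊢
    rwa [← map_one (valuation E), ← map_one (algebraMap F E), valuation_algebraMap_le, map_one]
  have hπ2 : OrdEq π 2 (π ^ 2) := by simpa using (ordEq_self π).pow 2
  have h3 : algebraMap F E Δ ∈ fracPow π 1 := by
    rw [mem_fracPow, zpow_one]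
    exact hπ.maximal _ (h1.trans_lt h2)
  have h4 : algebraMap F E ϖ ∈ fracPow π 2 := by
    rw [hP]
    exact neg_mem (add_mem hπ2.mem (hπ.mul_mem h3 (ordEq_self π).mem (by norm_num)))
  have h5 : algebraMap F E Δ ∈ fracPow π 2 := mem_fracPow.2 (h1.trans h4)
  rw [hP]
  exact (hπ2.add hπ (hπ.mul_mem h5 (ordEq_self π).mem le_rfl) (by norm_num)).neg

variable [TopologicalSpace F] [IsNonarchimedeanLocalField F]

section
variable (hπ : IsUnif π) (hϖ : IsUnif ϖ) (h : OrdEq π 2 (algebraMap F E ϖ))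
include hπ hϖ h

theorem algebraMap_mul_ord {w : F} (hw : w ≠ 0) :
    ∃ k : ℤ, OrdEq π (2 * k) (algebraMap F E w) ∧ OrdEq π (2 * k + 1) (algebraMap F E w * π) := by
  obtain ⟨k, hk⟩ := hϖ.exists_ordEq hw
  have := algebraMap_ordEq h hk
  exact ⟨k, this, this.mul hπ (ordEq_self π)⟩

/-- Parity: elements of `F` have even order in `E`, and multiplication by `π` makes the order odd.
Hence no cancellation can occur in `u + w π`. -/
theorem valuation_algebraMap_ne {u w : F} (hw : w ≠ 0) :
    valuation E (algebraMap F E u) ≠ valuation E (algebraMap F E w * π) := by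
  intro heq
  obtain ⟨k, -, hk⟩ := algebraMap_mul_ord hπ hϖ h hw
  have hu : u ≠ 0 := by
    rintro rfl
    rw [map_zero, map_zero] at heq
    exact hk.ne_zero hπ ((valuation E).zero_iff.1 heq.symm)
  obtain ⟨j, hj, -⟩ := algebraMap_mul_ord hπ hϖ h hu
  have := OrdEq.unique hπ hj (heq.trans hk)
  omega

theorem valuation_mul_le (u w : F) : valuation E (algebraMap F E w * π) ≤
    valuation E (algebraMap F E u + algebraMap F E w * π) := by
  by_cases hw : w = 0
  · simp [hw]
  refine not_lt.1 fun hlt => valuation_algebraMap_ne hπ hϖ h (u := u) hw ?_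
  rw [← Valuation.map_sub_eq_of_lt_left (valuation E) hlt, ← (valuation E).map_neg]
  congr 1
  ring

theorem exists_eq_add_mul (hdeg : Module.finrank F E = 2) (e : E) :
    ∃ u w : F, e = algebraMap F E u + algebraMap F E w * π := by
  have hli : LinearIndependent F ![(1 : E), π] := by
    rw [LinearIndependent.pair_iff]
    intro s t hst
    rw [Algebra.smul_def, Algebra.smul_def, mul_one] at hst
    have ht : t = 0 := by
      by_contra ht
      refine valuation_algebraMap_ne hπ hϖ h (u := s) ht ?_
      rw [eq_neg_of_add_eq_zero_left hst, Valuation.map_neg]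
    subst ht
    simpa using hst
  have : FiniteDimensional F E := Module.finite_of_finrank_pos (by omega)
  have hsp := hli.span_eq_top_of_card_eq_finrank' (by simp [hdeg])
  have he : e ∈ Submodule.span F (Set.range ![(1 : E), π]) := by rw [hsp]; trivial
  rw [Matrix.range_cons, Matrix.range_cons, Matrix.range_empty, Set.union_empty,
    Set.singleton_union, Submodule.mem_span_pair] at he
  obtain ⟨u, w, rfl⟩ := he
  exact ⟨u, w, by rw [Algebra.smul_def, Algebra.smul_def, mul_one]⟩

/-- Total ramification: in an integral `u + w π` the second summand is integral of odd order, hence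
lies in the maximal ideal, so `u` already represents the residue class. -/
theorem card_residueField_eq (hall : ∀ e : E, ∃ u w : F, e = algebraMap F E u + algebraMap F E w * π) :
    Nat.card 𝓀[E] = Nat.card 𝓀[F] := by
  have hone : ∀ x : F, valuation E (algebraMap F E x) ≤ 1 ↔ valuation F x ≤ 1 := by
    intro x
    rw [← map_one (valuation E), ← map_one (algebraMap F E), valuation_algebraMap_le, map_one]
  have hlt : ∀ x : F, valuation E (algebraMap F E x) < 1 ↔ valuation F x < 1 := by
    intro x
    rw [← not_le, ← not_le, not_iff_not, ← map_one (valuation E), ← map_one (algebraMap F E),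
      valuation_algebraMap_le, map_one]
  let f : 𝒪[F] →+* 𝒪[E] := ((algebraMap F E).comp 𝒪[F].subtype).codRestrict 𝒪[E]
    fun x => (hone _).2 x.2
  let g : 𝒪[F] →+* 𝓀[E] := (IsLocalRing.residue 𝒪[E]).comp f
  have hker : RingHom.ker g = 𝓂[F] := by
    ext x
    rw [RingHom.mem_ker, RingHom.comp_apply, IsLocalRing.residue_eq_zero_iff, mem_maxIdeal_iff,
      mem_maxIdeal_iff]
    exact hlt x
  have hsurj : Function.Surjective g := by
    intro y
    obtain ⟨e, rfl⟩ := IsLocalRing.residue_surjective y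
    obtain ⟨u, w, he⟩ := hall e
    have h1 : valuation E (algebraMap F E w * π) ≤ 1 :=
      (valuation_mul_le hπ hϖ h u w).trans (he ▸ e.2)
    have h2 : valuation E (algebraMap F E w * π) < 1 := by
      refine lt_of_le_of_ne h1 fun h3 => ?_
      by_cases hw : w = 0
      · simp [hw] at h3
      · refine valuation_algebraMap_ne hπ hϖ h (u := 1) hw ?_
        rw [h3, map_one, map_one]
    have hu : algebraMap F E u = e - algebraMap F E w * π := by rw [he]; ring
    have hu1 : valuation F u ≤ 1 := by
      rw [← hone, hu]
      exact (Valuation.map_sub _ _ _).trans (max_le e.2 h1)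
    refine ⟨⟨u, hu1⟩, ?_⟩
    rw [RingHom.comp_apply, ← sub_eq_zero, ← map_sub, IsLocalRing.residue_eq_zero_iff,
      mem_maxIdeal_iff]
    have : (((f ⟨u, hu1⟩ - e : 𝒪[E])) : E) = -(algebraMap F E w * π) := by
      change algebraMap F E u - e = _
      rw [hu]; ring
    rwa [this, Valuation.map_neg]
  exact (Nat.card_congr ((Ideal.quotEquivOfEq hker).symm.trans
    (RingHom.quotientKerEquivOfSurjective hsurj)).toEquiv).symm

end

/-- In characteristic `2` the second root of the minimal polynomial is `π + Δ`, so `τ` adds `w Δ` to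
`u + w π`. As `Δ` has order `d + 1 > 1` in `E`, this correction is smaller than `w π`; if the
element has order `1`, then `w` is a unit and the difference has order exactly `d + 1`. -/
theorem wildQuadratic_of_minpoly [CharP F 2] [TopologicalSpace E] [IsNonarchimedeanLocalField E]
    (hdeg : Module.finrank F E = 2) (τ : E ≃ₐ[F] E) (hτ : τ ≠ AlgEquiv.refl) {d : ℕ} (hd : Odd d)
    {Δ : F} (hϖ : HasOrd ϖ 1) (hπ : HasOrd π 1) (hΔ : HasOrd Δ ((d + 1) / 2))
    (hmin : π ^ 2 + algebraMap F E Δ * π + algebraMap F E ϖ = 0) :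
    WildQuadratic τ π ϖ d := by
  have uE := hπ.isUnif
  have uF := hϖ.isUnif
  obtain ⟨d', rfl⟩ := hd
  have hd' : (2 * d' + 1 + 1) / 2 = d' + 1 := by omega
  rw [hd', uF.hasOrd_iff] at hΔ
  have h2 : OrdEq π 2 (algebraMap F E ϖ) := by
    refine ordEq_algebraMap_uniformizer uE ?_ uF.lt_one hmin
    have := uF.fracPow_anti (i := 1) (by push_cast; omega) hΔ.mem
    rwa [mem_fracPow, zpow_one] at this
  have hΔE : OrdEq π (2 * d' + 2) (algebraMap F E Δ) := by
    have := algebraMap_ordEq h2 hΔ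
    convert this using 1
    push_cast; ring
  have hall := exists_eq_add_mul uE uF h2 hdeg
  have : CharP E 2 := charP_of_injective_algebraMap (algebraMap F E).injective 2
  have hτπ : τ π = π + algebraMap F E Δ := by
    have h1 : τ π ^ 2 + algebraMap F E Δ * τ π + algebraMap F E ϖ = 0 := by
      simpa using congrArg τ hmin
    have h3 : (τ π - π) * (τ π - (π + algebraMap F E Δ)) = 0 := by
      rw [CharTwo.sub_eq_add (τ π) (π + _)]
      linear_combination h1 - hmin
    rcases mul_eq_zero.1 h3 with h4 | h4
    · refine absurd (AlgEquiv.ext fun e => ?_) hτ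
      obtain ⟨u, w, rfl⟩ := hall e
      simp [sub_eq_zero.1 h4]
    · exact sub_eq_zero.1 h4
  have hτe : ∀ u w : F, τ (algebraMap F E u + algebraMap F E w * π) =
      algebraMap F E u + algebraMap F E w * π + algebraMap F E w * algebraMap F E Δ := by
    intro u w
    rw [map_add, map_mul, τ.commutes, τ.commutes, hτπ]
    ring
  have hlt : ∀ w : F, w ≠ 0 → valuation E (algebraMap F E w * algebraMap F E Δ) <
      valuation E (algebraMap F E w * π) := by
    intro w hw
    have hw' : (0 : ValueGroupWithZero E) < valuation E (algebraMap F E w) := by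
      rw [zero_lt_iff, Ne, Valuation.zero_iff]
      exact (map_ne_zero _).2 hw
    rw [map_mul, map_mul]
    refine mul_lt_mul_of_pos_left ?_ hw'
    rw [hΔE]
    conv_rhs => rw [← zpow_one (valuation E π)]
    exact zpow_lt_zpow_right_of_lt_one₀ uE.pos uE.lt_one (by omega)
  refine ⟨uE, uF, fun x => ?_, fun x => ?_, ?_, fun x k => algebraMap_mem_fracPow h2,
    fun x k => algebraMap_ordEq h2, hall,
    fun a ha => ?_, card_residueField_eq uE uF h2 hall⟩
  · obtain ⟨u, w, rfl⟩ := hall x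
    rw [hτe]
    by_cases hw : w = 0
    · simp [hw]
    · exact Valuation.map_add_eq_of_lt_left _
        ((hlt w hw).trans_le (valuation_mul_le uE uF h2 u w))
  · obtain ⟨u, w, rfl⟩ := hall x
    rw [hτe, map_add, hτe, map_mul, τ.commutes, τ.commutes, add_assoc, CharTwo.add_self_eq_zero,
      add_zero]
  · rw [hτπ, ← sub_eq_zero, CharTwo.sub_eq_add]
    linear_combination hmin
  · obtain ⟨u, w, rfl⟩ := hall a
    have hw : w ≠ 0 := by
      rintro rfl
      have hu : u ≠ 0 := by
        rintro rfl
        exact ha.ne_zero uE (by simp)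
      obtain ⟨k, hk, -⟩ := algebraMap_mul_ord uE uF h2 hu
      rw [map_zero, zero_mul, add_zero] at ha
      have := ha.unique uE hk
      omega
    obtain ⟨k, hk, hk'⟩ := algebraMap_mul_ord uE uF h2 hw
    have hle := valuation_mul_le uE uF h2 u w
    have hk1 : (1 : ℤ) ≤ 2 * k + 1 := by
      rw [← hk'.mem_iff uE]
      exact mem_fracPow.2 (hle.trans ha.le)
    -- If `w π` had order above `1`, then `u` would have order `1`, which is odd.
    have hk0 : 2 * k = 0 := by
      rcases eq_or_lt_of_le hk1 with h0 | h0
      · omega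
      · exfalso
        have hu1 : OrdEq π 1 (algebraMap F E u) := by
          have := ha.sub uE hk'.mem h0
          rwa [add_sub_cancel_right] at this
        have hu : u ≠ 0 := by
          rintro rfl
          exact hu1.ne_zero uE (map_zero _)
        obtain ⟨j, hj, -⟩ := algebraMap_mul_ord uE uF h2 hu
        have := hu1.unique uE hj
        omega
    rw [hτe, add_sub_cancel_left]
    have := hk.mul uE hΔE
    convert this using 1
    push_cast
    omega

end Extension


/-! ### The Iwahori filtration in coordinates -/

theorem scalar_mem_center {L : Type*} [Field L] (u : Lˣ) :
    Matrix.GeneralLinearGroup.scalar (Fin 2) u ∈ Subgroup.center (GL (Fin 2) L) :=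
  Subgroup.mem_center_iff.2 fun g => (Matrix.GeneralLinearGroup.scalar_commute u g).symm

theorem scalar_mul_apply {L : Type*} [Field L] (u : Lˣ) (g : GL (Fin 2) L) (i j : Fin 2) :
    (Matrix.GeneralLinearGroup.scalar (Fin 2) u * g) i j = u * g i j := by
  rw [Units.val_mul, Matrix.GeneralLinearGroup.coe_scalar, Matrix.scalar_apply,
    Matrix.diagonal_mul]

theorem galGL_apply {F E : Type*} [Field F] [Field E] [Algebra F E] (τ : E ≃ₐ[F] E)
    (g : GL (Fin 2) E) (i j : Fin 2) : galGL τ g i j = τ (g i j) := rfl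

section Iwahori

open ValuativeRel

variable {L : Type*} [Field L] [ValuativeRel L] {π : L}

theorem IsUnif.mem_chainPow_iff (h : IsUnif π) {k : ℕ} {x : Matrix (Fin 2) (Fin 2) L} :
    x ∈ chainPow L k ↔ x 0 0 ∈ fracPow π ((k + 1) / 2 : ℕ) ∧ x 0 1 ∈ fracPow π (k / 2 : ℕ) ∧
      x 1 0 ∈ fracPow π ((k / 2 + 1 : ℕ) : ℤ) ∧ x 1 1 ∈ fracPow π ((k + 1) / 2 : ℕ) := by
  rw [← h.mem_maxPow_iff, ← h.mem_maxPow_iff, ← h.mem_maxPow_iff, ← h.mem_maxPow_iff]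
  rfl

theorem IsUnif.mem_chainPow_odd (h : IsUnif π) {m : ℕ} {x : Matrix (Fin 2) (Fin 2) L} :
    x ∈ chainPow L (2 * m + 1) ↔ x 0 0 ∈ fracPow π (m + 1) ∧ x 0 1 ∈ fracPow π m ∧
      x 1 0 ∈ fracPow π (m + 1) ∧ x 1 1 ∈ fracPow π (m + 1) := by
  have h1 : (2 * m + 1 + 1) / 2 = m + 1 := by omega
  have h2 : (2 * m + 1) / 2 = m := by omega
  rw [h.mem_chainPow_iff, h1, h2]
  push_cast
  rfl

theorem IsUnif.mem_chainPow_zero (h : IsUnif π) {x : Matrix (Fin 2) (Fin 2) L} :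
    x ∈ chainPow L 0 ↔ x 0 0 ∈ fracPow π 0 ∧ x 0 1 ∈ fracPow π 0 ∧
      x 1 0 ∈ fracPow π 1 ∧ x 1 1 ∈ fracPow π 0 := by
  rw [h.mem_chainPow_iff]
  rfl

theorem IsUnif.ordEq_zero_of_mul {x y : L} (h : IsUnif π) (hx : x ∈ fracPow π 0)
    (hy : y ∈ fracPow π 0) (hxy : x * y - 1 ∈ fracPow π 1) : OrdEq π 0 x := by
  refine h.ordEq_iff.2 ⟨hx, fun h1 => ?_⟩
  have h2 : (1 : L) ∈ fracPow π 1 := by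
    have h3 := sub_mem (h.mul_mem h1 hy (k := 1) (by norm_num)) hxy
    rwa [sub_sub_cancel] at h3
  have := ((ordEq_one π).mem_iff h).1 h2
  omega

/-- The diagonal entries are units because the off-diagonal contributions to `g g⁻¹ = 1` lie in `𝔭`.
Conversely the determinant is a unit, and the adjugate formula bounds the inverse. -/
theorem IsUnif.mem_iwahori_iff (h : IsUnif π) {g : GL (Fin 2) L} :
    g ∈ iwahori L ↔ OrdEq π 0 (g 0 0) ∧ g 0 1 ∈ fracPow π 0 ∧ g 1 0 ∈ fracPow π 1 ∧
      OrdEq π 0 (g 1 1) := by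
  constructor
  · rintro ⟨h1, h2⟩
    rw [h.mem_chainPow_zero] at h1 h2
    obtain ⟨a1, a2, a3, a4⟩ := h1
    obtain ⟨b1, b2, b3, b4⟩ := h2
    have e : (g : Matrix (Fin 2) (Fin 2) L) * (g⁻¹ : GL (Fin 2) L) = 1 := Units.mul_inv g
    have e0 := congrFun (congrFun e 0) 0
    have e1 := congrFun (congrFun e 1) 1
    rw [Matrix.mul_apply, Fin.sum_univ_two, Matrix.one_apply_eq] at e0 e1
    refine ⟨h.ordEq_zero_of_mul a1 b1 ?_, a2, a3, h.ordEq_zero_of_mul a4 b4 ?_⟩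
    · rw [← e0, sub_add_cancel_left]
      exact neg_mem (h.mul_mem a2 b3 (by norm_num))
    · rw [← e1, sub_add_cancel_right]
      exact neg_mem (h.mul_mem a3 b2 (by norm_num))
  · rintro ⟨a1, a2, a3, a4⟩
    refine ⟨h.mem_chainPow_zero.2 ⟨a1.mem, a2, a3, a4.mem⟩, h.mem_chainPow_zero.2 ?_⟩
    have hd : OrdEq π 0 (g 0 0 * g 1 1 - g 0 1 * g 1 0) :=
      OrdEq.sub h (by simpa using a1.mul h a4) (h.mul_mem a2 a3 (le_refl (0 + 1))) (by norm_num)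
    have hi : (((g⁻¹ : GL (Fin 2) L) : Matrix (Fin 2) (Fin 2) L)) =
        (g 0 0 * g 1 1 - g 0 1 * g 1 0)⁻¹ • !![g 1 1, -g 0 1; -g 1 0, g 0 0] := by
      rw [Matrix.GeneralLinearGroup.coe_inv, Matrix.inv_def, Matrix.adjugate_fin_two,
        Ring.inverse_eq_inv', Matrix.det_fin_two]
    have hd' : (g 0 0 * g 1 1 - g 0 1 * g 1 0)⁻¹ ∈ fracPow π 0 := by simpa using hd.inv.mem
    rw [hi]
    exact ⟨h.mul_mem hd' a4.mem le_rfl, h.mul_mem hd' (neg_mem a2) le_rfl,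
      h.mul_mem hd' (neg_mem a3) le_rfl, h.mul_mem hd' a1.mem le_rfl⟩

theorem inv_mul_mem_iwahoriLevel {k : ℕ} {g h : GL (Fin 2) L} (hg : g ∈ iwahori L)
    (hh : h ∈ iwahori L)
    (hgh : (h : Matrix (Fin 2) (Fin 2) L) - (g : Matrix (Fin 2) (Fin 2) L) ∈ chainPow L k) :
    g⁻¹ * h ∈ iwahoriLevel L k := by
  refine ⟨mul_mem (inv_mem hg) hh, ?_⟩
  have e : ((g⁻¹ * h : GL (Fin 2) L) : Matrix (Fin 2) (Fin 2) L) - 1 =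
      ((g⁻¹ : GL (Fin 2) L) : Matrix (Fin 2) (Fin 2) L) * ((h : Matrix (Fin 2) (Fin 2) L) - g) := by
    rw [mul_sub, Units.inv_mul, Units.val_mul]
  rw [e]
  exact mul_mem_chainPow (Or.inl ⟨rfl, rfl⟩) hg.2 hgh

theorem mem_centerIwahori_iff {g : GL (Fin 2) L} :
    g ∈ centerIwahori L ↔ ∃ u : Lˣ, Matrix.GeneralLinearGroup.scalar (Fin 2) u * g ∈ iwahori L := by
  rw [centerIwahori, Subgroup.mem_sup_of_normal_left]
  constructor
  · rintro ⟨z, hz, i, hi, rfl⟩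
    rw [Matrix.GeneralLinearGroup.center_eq_range_scalar] at hz
    obtain ⟨u, rfl⟩ := hz
    refine ⟨u⁻¹, ?_⟩
    rwa [map_inv, inv_mul_cancel_left]
  · rintro ⟨u, hu⟩
    refine ⟨Matrix.GeneralLinearGroup.scalar (Fin 2) u⁻¹, scalar_mem_center _, _, hu, ?_⟩
    rw [map_inv, inv_mul_cancel_left]

theorem iwahori_le_centerIwahori : iwahori L ≤ centerIwahori L := le_sup_right

theorem conj_mem_iwahoriLevel' {k : ℕ} {g h : GL (Fin 2) L} (hg : g ∈ centerIwahori L)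
    (hh : h ∈ iwahoriLevel L k) : g⁻¹ * h * g ∈ iwahoriLevel L k := by
  simpa using conj_mem_iwahoriLevel (inv_mem hg) hh

end Iwahori

/-! ### The stabilizer of the double coset -/

section Stabilizer

open ValuativeRel

variable {F E : Type*} [Field F] [Field E] [ValuativeRel E] [Algebra F E]
  {τ : E ≃ₐ[F] E}

theorem galGL_mem_centerIwahori {π : E} (hπ : IsUnif π)
    (hτ : ∀ x, valuation E (τ x) = valuation E x) {g : GL (Fin 2) E} (hg : g ∈ centerIwahori E) :
    galGL τ g ∈ centerIwahori E := by
  obtain ⟨u, hu⟩ := mem_centerIwahori_iff.1 hg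
  refine mem_centerIwahori_iff.2 ⟨galUnit τ u, ?_⟩
  have e : Matrix.GeneralLinearGroup.scalar (Fin 2) (galUnit τ u) * galGL τ g =
      galGL τ (Matrix.GeneralLinearGroup.scalar (Fin 2) u * g) := by
    rw [map_mul]
    congr 1
    exact (Matrix.GeneralLinearGroup.map_scalar (τ : E →+* E) u).symm
  rw [e, hπ.mem_iwahori_iff]
  simpa only [galGL_apply, OrdEq, mem_fracPow, hτ] using hπ.mem_iwahori_iff.1 hu

/-- As `i` and `i'` normalize `J`, the set `i⁻¹ J ẇ J i'` is a single double coset of `J`; it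
therefore lies in `J ẇ J` once one of its elements does. Membership in the stabilizer can thus be
tested on one matrix. -/
theorem twisted_conj_mem {π : Eˣ} {n m : ℕ} {i i' M : GL (Fin 2) E} (hi : i ∈ centerIwahori E)
    (hi' : i' ∈ centerIwahori E) (hM : M ∈ doubleCosetW τ π n m)
    (hM' : i⁻¹ * M * i' ∈ doubleCosetW τ π n m) {g : GL (Fin 2) E}
    (hg : g ∈ doubleCosetW τ π n m) : i⁻¹ * g * i' ∈ doubleCosetW τ π n m := by
  obtain ⟨j, hj, j', hj', rfl⟩ := hM
  obtain ⟨k, hk, k', hk', hkk⟩ := hM'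
  obtain ⟨l, hl, l', hl', rfl⟩ := hg
  have e : wDot τ π n = j⁻¹ * i * (k * wDot τ π n * k') * i'⁻¹ * j'⁻¹ := by
    rw [← hkk]; group
  refine ⟨i⁻¹ * l * i * (i⁻¹ * j * i)⁻¹ * k, ?_, k' * (i'⁻¹ * j' * i')⁻¹ * (i'⁻¹ * l' * i'), ?_, ?_⟩
  · exact mul_mem (mul_mem (conj_mem_iwahoriLevel' hi hl)
      (inv_mem (conj_mem_iwahoriLevel' hi hj))) hk
  · exact mul_mem (mul_mem hk' (inv_mem (conj_mem_iwahoriLevel' hi' hj')))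
      (conj_mem_iwahoriLevel' hi' hl')
  · conv_lhs => rw [e]
    group

theorem mem_preGamma_of {π : Eˣ} (hπ : IsUnif (π : E))
    (hτ : ∀ x, valuation E (τ x) = valuation E x) {n m : ℕ} {i : centerIwahori E}
    {M : GL (Fin 2) E} (hM : M ∈ doubleCosetW τ π n m)
    (hM' : (i : GL (Fin 2) E)⁻¹ * M * galGL τ i ∈ doubleCosetW τ π n m) :
    i ∈ preGamma τ π n m := by
  have hi := galGL_mem_centerIwahori hπ hτ i.2
  intro g
  refine ⟨twisted_conj_mem i.2 hi hM hM', fun hg => ?_⟩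
  have h := twisted_conj_mem (i := (i : GL (Fin 2) E)⁻¹) (i' := (galGL τ (i : GL (Fin 2) E))⁻¹)
    (inv_mem i.2) (inv_mem hi) hM' (by
      convert hM using 1
      group) hg
  convert h using 1
  group

theorem wDot_mem {π : Eˣ} {n m : ℕ} : wDot τ π n ∈ doubleCosetW τ π n m :=
  ⟨1, one_mem _, 1, one_mem _, by simp⟩

/-- Two points of the variety with the same image in `GL₂(E) / Z(E) I_E` differ by `Γ̃`. -/
theorem exists_smul_eq {π : Eˣ} (hπ : IsUnif (π : E))
    (hτ : ∀ x, valuation E (τ x) = valuation E x) {n m : ℕ} {g : GL (Fin 2) E} {c : GL (Fin 2) E}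
    (hc : c ∈ centerIwahori E) (hg : g⁻¹ * galGL τ g ∈ doubleCosetW τ π n m)
    (hgc : (g * c)⁻¹ * galGL τ (g * c) ∈ doubleCosetW τ π n m) :
    ∃ γ : GammaTilde τ π n m, (γ : LevelQuotient E m) = QuotientGroup.mk ⟨c, hc⟩ ∧
      MulOpposite.op γ • CosetSpace.mk m g = CosetSpace.mk m (g * c) := by
  have h : (⟨c, hc⟩ : centerIwahori E) ∈ preGamma τ π n m := by
    refine mem_preGamma_of hπ hτ hg ?_
    convert hgc using 1
    rw [map_mul]
    group
  exact ⟨⟨QuotientGroup.mk ⟨c, hc⟩, ⟨_, h, rfl⟩⟩, rfl, rfl⟩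

theorem gammaTilde_exists_rep {π : Eˣ} {n m : ℕ} (γ : GammaTilde τ π n m) :
    ∃ i : centerIwahori E, i ∈ preGamma τ π n m ∧ (γ : LevelQuotient E m) = QuotientGroup.mk i ∧
      ∀ g, MulOpposite.op γ • CosetSpace.mk m g = CosetSpace.mk m (g * (i : GL (Fin 2) E)) := by
  obtain ⟨_, i, hi, rfl⟩ := γ
  exact ⟨i, hi, rfl, fun g => rfl⟩

/-- Right multiplication fixes `g J` only if the multiplier lies in `J`, that is, is trivial in the
quotient. -/
theorem gammaTilde_free {π : Eˣ} {n m : ℕ} (x : CosetSpace E m) (γ : GammaTilde τ π n m)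
    (h : MulOpposite.op γ • x = x) : γ = 1 := by
  obtain ⟨g, rfl⟩ := x.mk_surjective
  obtain ⟨i, -, hi, hγ⟩ := gammaTilde_exists_rep γ
  rw [hγ, eq_comm, CosetSpace.mk_eq, inv_mul_cancel_left] at h
  refine Subtype.ext (hi.trans ?_)
  exact (QuotientGroup.eq_one_iff i).2 h

/-- The condition defining the variety does not depend on the representative, because `τ` preserves
valuations and hence `J`. -/
theorem mk_mem_variety_iff {π : Eˣ} (hπ : IsUnif (π : E))
    (hτ : ∀ x, valuation E (τ x) = valuation E x) {n m : ℕ} {g : GL (Fin 2) E} :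
    CosetSpace.mk m g ∈ variety τ π n m ↔ g⁻¹ * galGL τ g ∈ doubleCosetW τ π n m := by
  refine ⟨?_, fun h => ⟨g, rfl, h⟩⟩
  rintro ⟨g', h, j, hj, j', hj', e⟩
  rw [CosetSpace.mk_eq] at h
  have hgal : galGL τ (g⁻¹ * g') ∈ iwahoriLevel E (2 * m + 1) := by
    refine ⟨?_, ?_⟩
    · rw [hπ.mem_iwahori_iff]
      simpa only [galGL_apply, OrdEq, mem_fracPow, hτ] using hπ.mem_iwahori_iff.1 h.1
    · have h2 := h.2
      have e' : ((galGL τ (g⁻¹ * g') : GL (Fin 2) E) : Matrix (Fin 2) (Fin 2) E) - 1 =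
          (((g⁻¹ * g' : GL (Fin 2) E) : Matrix (Fin 2) (Fin 2) E) - 1).map τ := by
        ext a b
        rw [Matrix.map_apply, Matrix.sub_apply, Matrix.sub_apply, galGL_apply, map_sub]
        congr 1
        rw [Matrix.one_apply, apply_ite τ, map_one, map_zero]
      rw [hπ.mem_chainPow_odd] at h2 ⊢
      rw [e']
      simpa only [Matrix.map_apply, mem_fracPow, hτ] using h2
  refine ⟨g⁻¹ * g' * j, mul_mem h hj, j' * (galGL τ (g⁻¹ * g'))⁻¹, mul_mem hj' (inv_mem hgal), ?_⟩
  calc g⁻¹ * galGL τ g = g⁻¹ * g' * (g'⁻¹ * galGL τ g') * (galGL τ (g⁻¹ * g'))⁻¹ := by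
        rw [map_mul, map_inv]; group
    _ = _ := by rw [e]; group

end Stabilizer


/-! ### Points of the variety over the Schubert cell -/

section Cell

open ValuativeRel

variable {E : Type*} [Field E]

theorem val_lower (a : E) : (lower a : Matrix (Fin 2) (Fin 2) E) = !![1, 0; a, 1] := rfl

theorem val_inv_lower (a : E) :
    ((lower a)⁻¹ : GL (Fin 2) E).1 = !![1, 0; -a, 1] := rfl

theorem val_diag (x y : Eˣ) :
    (diag x y : Matrix (Fin 2) (Fin 2) E) = !![(x : E), 0; 0, (y : E)] := rfl

theorem lower_vDot_val {π : Eˣ} {p s : E} {n d : ℕ}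
    (hv : (vDot π n d : Matrix (Fin 2) (Fin 2) E) = !![0, p; s, 0]) (a : E) :
    ((lower a * vDot π n d : GL (Fin 2) E) : Matrix (Fin 2) (Fin 2) E) = !![0, p; s, a * p] := by
  rw [Units.val_mul, hv, val_lower, Matrix.mul_fin_two]
  simp

theorem lower_vDot_inv_mul {π : Eˣ} {p s : E} {n d : ℕ}
    (hv : ((vDot π n d)⁻¹ : GL (Fin 2) E).1 = !![0, s⁻¹; p⁻¹, 0]) (a : E) (g : GL (Fin 2) E) :
    (((lower a * vDot π n d)⁻¹ * g : GL (Fin 2) E) : Matrix (Fin 2) (Fin 2) E) =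
      !![s⁻¹ * (g 1 0 - a * g 0 0), s⁻¹ * (g 1 1 - a * g 0 1); p⁻¹ * g 0 0, p⁻¹ * g 0 1] := by
  rw [mul_inv_rev, Units.val_mul, Units.val_mul, hv, val_inv_lower,
    Matrix.eta_fin_two (g : Matrix (Fin 2) (Fin 2) E), Matrix.mul_fin_two, Matrix.mul_fin_two]
  ext i j
  fin_cases i <;> fin_cases j <;> simp <;> ring

variable [ValuativeRel E] {π : Eˣ}

/-- Only the difference `n + d + 1` of the two orders is used later. It comes out exactly because
`d` is odd and `⌊n/2⌋ + ⌊(n+1)/2⌋ = n`. -/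
theorem exists_vDot_eq {d : ℕ} (hd : Odd d) (n : ℕ) :
    ∃ (p s : E) (i j : ℤ), OrdEq (π : E) i p ∧ OrdEq (π : E) j s ∧ j - i = n + d + 1 ∧
      (vDot π n d : Matrix (Fin 2) (Fin 2) E) = !![0, p; s, 0] ∧
      ((vDot π n d)⁻¹ : GL (Fin 2) E).1 = !![0, s⁻¹; p⁻¹, 0] := by
  refine ⟨((π ^ (-(((d + 1) / 2 + (n + 1) / 2 : ℕ) : ℤ)) : Eˣ) : E),
    ((π ^ ((d + 1) / 2 + n / 2) : Eˣ) : E), -(((d + 1) / 2 + (n + 1) / 2 : ℕ) : ℤ),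
    ((d + 1) / 2 + n / 2 : ℕ), ?_, ?_, ?_, rfl, ?_⟩
  · rw [Units.val_zpow_eq_zpow_val]
    exact ordEq_zpow _ _
  · rw [Units.val_pow_eq_pow_val, ← zpow_natCast]
    exact ordEq_zpow _ _
  · obtain ⟨c, rfl⟩ := hd
    omega
  · rw [← Units.val_inv_eq_inv_val, ← Units.val_inv_eq_inv_val]
    rfl

/-- Two points of the Schubert cell with the same image in `GL₂(E) / Z(E) I_E`. -/
theorem sub_mem_of_cell_eq (hπ : IsUnif (π : E)) {d : ℕ} (hd : Odd d) {n : ℕ} {a b : E}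
    {k c : GL (Fin 2) E} (hk : k ∈ centerIwahori E) (hc : c ∈ centerIwahori E)
    (h : lower a * vDot π n d * k = lower b * vDot π n d * c) :
    b - a ∈ fracPow (π : E) (n + d + 1) := by
  obtain ⟨p, s, i, j, hp, hs, hij, hv, hv'⟩ := exists_vDot_eq (π := π) hd n
  have hp0 := hp.ne_zero hπ
  have hs0 := hs.ne_zero hπ
  -- The left side is the upper unipotent matrix with entry `(b - a) p / s`. It lies in `Z(E) I_E`,
  -- and its diagonal entry `1` forces the scalar `u` to be a unit; hence `(b - a) p / s` is
  -- integral.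
  have e : (lower a * vDot π n d)⁻¹ * (lower b * vDot π n d) = k * c⁻¹ := by
    rw [inv_mul_eq_iff_eq_mul, ← mul_assoc, h, mul_inv_cancel_right]
  obtain ⟨u, hu⟩ := mem_centerIwahori_iff.1 (mul_mem hk (inv_mem hc))
  rw [← e, hπ.mem_iwahori_iff] at hu
  obtain ⟨h1, h2, -, -⟩ := hu
  rw [scalar_mul_apply, lower_vDot_inv_mul hv', lower_vDot_val hv] at h1 h2
  simp only [Matrix.of_apply, Matrix.cons_val', Matrix.cons_val_zero, Matrix.cons_val_one,
    Matrix.cons_val_fin_one, mul_zero, sub_zero, inv_mul_cancel₀ hs0, mul_one] at h1 h2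
  have h3 := hπ.mul_mem (h1.inv.mul hπ (hs.div hπ hp)).mem h2 (k := n + d + 1) (by omega)
  convert h3 using 1
  have := u.ne_zero
  field_simp

theorem exists_cell_eq (hπ : IsUnif (π : E)) {d : ℕ} (hd : Odd d) {n : ℕ} {a b : E}
    (hab : b - a ∈ fracPow (π : E) (n + d + 1)) :
    ∃ c ∈ iwahori E, lower b * vDot π n d = lower a * vDot π n d * c := by
  obtain ⟨p, s, i, j, hp, hs, hij, hv, hv'⟩ := exists_vDot_eq (π := π) hd n
  have hp0 := hp.ne_zero hπ
  have hs0 := hs.ne_zero hπ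
  refine ⟨(lower a * vDot π n d)⁻¹ * (lower b * vDot π n d), ?_, by group⟩
  rw [hπ.mem_iwahori_iff, lower_vDot_inv_mul hv', lower_vDot_val hv]
  simp only [Matrix.of_apply, Matrix.cons_val', Matrix.cons_val_zero, Matrix.cons_val_one,
    Matrix.cons_val_fin_one, mul_zero, sub_zero, inv_mul_cancel₀ hs0, inv_mul_cancel₀ hp0]
  refine ⟨ordEq_one _, ?_, zero_mem _, ordEq_one _⟩
  have h3 := hπ.mul_mem (hp.div hπ hs).mem hab (k := 0) (by omega)
  convert h3 using 1
  field_simp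

variable {F : Type*} [Field F] [ValuativeRel F] [Algebra F E] {τ : E ≃ₐ[F] E} {ϖ : F} {d : ℕ}

/-- The powers of `ε` in `ẇ` are what make `ẇ τ(ẇ) = 1`, a necessary condition for solving `τ(g) = g
ẇ` with an involution `τ`. The ratio `ϖ ^ n` of the two entries lies in `F`, which makes the twisted
centralizer of `ẇ` explicit. -/
theorem WildQuadratic.exists_wDot_eq (h : WildQuadratic τ (π : E) ϖ d) (n : ℕ) :
    ∃ α β : E, OrdEq (π : E) (-n) α ∧ τ α * β = 1 ∧ τ β * α = 1 ∧ β = algebraMap F E ϖ ^ n * α ∧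
      (wDot τ π n : Matrix (Fin 2) (Fin 2) E) = !![0, α; β, 0] := by
  have hη : τ (π : E) ≠ 0 := (map_ne_zero τ).2 π.ne_zero
  have hπ0 := π.ne_zero
  have hoη : OrdEq (π : E) 1 (τ π) := by rw [OrdEq, h.val_gal, zpow_one]
  obtain ⟨k, l, hk, hl, hn⟩ : ∃ k l : ℕ, n / 2 = k ∧ (n + 1) / 2 = l ∧ n = k + l :=
    ⟨_, _, rfl, rfl, by omega⟩
  have key : τ (((π : E) ^ n)⁻¹ * ((τ π / (π : E)) ^ l)⁻¹) *
      ((π : E) ^ n * (τ π / (π : E)) ^ k) = 1 := by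
    simp only [map_mul, map_inv₀, map_pow, map_div₀, h.gal_gal, hn, div_pow, pow_add]
    field_simp
  refine ⟨((π : E) ^ n)⁻¹ * ((τ π / (π : E)) ^ l)⁻¹, (π : E) ^ n * (τ π / (π : E)) ^ k, ?_, key, ?_,
    ?_, ?_⟩
  · have h1 := ((ordEq_self (π : E)).pow n).inv.mul h.unif
      (((hoη.div h.unif (ordEq_self (π : E))).pow l).inv)
    convert h1 using 1
    simp
  · have := congrArg τ key
    rw [map_mul, h.gal_gal, map_one] at this
    rw [mul_comm]
    exact this
  · rw [← h.norm, hn, div_pow, div_pow, mul_pow, pow_add, pow_add]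
    field_simp
  · rw [wDot, Units.val_mul, antidiag, val_diag, hk, hl, eps, galUnit]
    simp

/-- Lang's theorem over the Schubert cell, with the twist equal to `ẇ` on the nose. -/
theorem WildQuadratic.exists_lang (h : WildQuadratic τ (π : E) ϖ d) (hd : Odd d) {n : ℕ}
    (hn : 1 ≤ n) {a : E} (ha : OrdEq (π : E) 1 a) :
    ∃ (z : E) (x : Eˣ), z ∈ fracPow (π : E) n ∧ OrdEq (π : E) 0 (x : E) ∧
      lower z * diag x 1 ∈ iwahori E ∧
      galGL τ (lower a * vDot π n d * (lower z * diag x 1)) =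
        lower a * vDot π n d * (lower z * diag x 1) * wDot τ π n := by
  obtain ⟨p, s, i, j, hp, hs, hij, hv, -⟩ := exists_vDot_eq (π := π) hd n
  obtain ⟨α, β, hα, hαβ, -, -, hw⟩ := h.exists_wDot_eq n
  have hδ := h.ord_diff a ha
  have hp0 := hp.ne_zero h.unif
  have hs0 := hs.ne_zero h.unif
  have hα0 := hα.ne_zero h.unif
  have hδ0 := hδ.ne_zero h.unif
  have hτp0 : τ p ≠ 0 := (map_ne_zero τ).2 hp0
  have hτp : OrdEq (π : E) i (τ p) := by rw [OrdEq, h.val_gal, hp]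
  -- The values of `x` and `z` are found by equating the second columns of `τ(g)` and `g ẇ`. Their
  -- orders are `0` and `n` because `ord (τ(a) - a) = d + 1` and `j - i = n + d + 1`.
  have hx : OrdEq (π : E) 0 ((τ a - a) * τ p / (s * α)) := by
    have := (hδ.mul h.unif hτp).div h.unif (hs.mul h.unif hα)
    convert this using 1
    omega
  have hz : OrdEq (π : E) n (s / (p * (τ a - a))) := by
    have := hs.div h.unif (hp.mul h.unif hδ)
    convert this using 1
    omega
  obtain ⟨x, hxe⟩ := (hx.ne_zero h.unif).isUnit
  obtain ⟨z, hze⟩ : ∃ z, z = s / (p * (τ a - a)) := ⟨_, rfl⟩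
  rw [← hxe] at hx
  rw [← hze] at hz
  have hk : ((lower z * diag x 1 : GL (Fin 2) E) : Matrix (Fin 2) (Fin 2) E) =
      !![(x : E), 0; z * x, 1] := by
    rw [Units.val_mul, val_lower, val_diag, Matrix.mul_fin_two]
    simp
  refine ⟨z, x, hz.mem, hx, ?_, ?_⟩
  · rw [h.unif.mem_iwahori_iff, hk]
    exact ⟨hx, zero_mem _, h.unif.mul_mem hz.mem hx.mem (by omega), ordEq_one _⟩
  · have hg : ((lower a * vDot π n d * (lower z * diag x 1) : GL (Fin 2) E) :
        Matrix (Fin 2) (Fin 2) E) = !![p * z * x, p; (a * p * z + s) * x, a * p] := by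
      rw [Units.val_mul, lower_vDot_val hv, hk, Matrix.mul_fin_two]
      ext i j
      fin_cases i <;> fin_cases j <;> simp <;> ring
    have e1 : τ p = p * z * x * α := by
      rw [hze, hxe]
      field_simp
    have e2 : τ a * τ p = (a * p * z + s) * x * α := by
      rw [hze, hxe]
      field_simp
      ring
    -- The first column needs no new condition: it follows from the second by applying `τ` and using
    -- `τ(α) β = 1`.
    have e3 : τ (p * z * x) = p * β := by
      have := congrArg τ e1
      rw [h.gal_gal, map_mul] at this
      linear_combination (-τ (p * z * x)) * hαβ - β * this
    have e4 : τ ((a * p * z + s) * x) = a * p * β := by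
      have := congrArg τ e2
      rw [map_mul, h.gal_gal, h.gal_gal, map_mul] at this
      linear_combination (-τ ((a * p * z + s) * x)) * hαβ - β * this
    refine Units.ext ?_
    rw [Units.val_mul, hw, hg, Matrix.mul_fin_two]
    ext i j
    rw [galGL_apply, hg]
    fin_cases i <;> fin_cases j
    · simpa using e3
    · simpa using e1
    · simpa using e4
    · simpa using e2

theorem WildQuadratic.lang_mem (h : WildQuadratic τ (π : E) ϖ d) {n : ℕ} (m : ℕ) {a : E}
    (ha : OrdEq (π : E) 1 a) {k : GL (Fin 2) E} (hk : k ∈ iwahori E)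
    (hg : galGL τ (lower a * vDot π n d * k) = lower a * vDot π n d * k * wDot τ π n) :
    CosetSpace.mk m (lower a * vDot π n d * k) ∈ varietyHalf τ π n m d := by
  refine ⟨⟨_, rfl, ?_⟩, a, (h.unif.hasOrd_iff).2 ha, _, hk, rfl⟩
  rw [hg, inv_mul_cancel_left]
  exact wDot_mem

/-- The Lang solution serves as a base point: every point of the variety over the same point of the
cell is a `Γ̃`-translate of it. -/
theorem WildQuadratic.exists_smul_lang (h : WildQuadratic τ (π : E) ϖ d) {n m : ℕ} {a : E}
    (ha : OrdEq (π : E) 1 a) {k : GL (Fin 2) E} (hk : k ∈ iwahori E)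
    (hg : galGL τ (lower a * vDot π n d * k) = lower a * vDot π n d * k * wDot τ π n)
    {c : GL (Fin 2) E} (hc : c ∈ centerIwahori E)
    (hx : CosetSpace.mk m (lower a * vDot π n d * c) ∈ variety τ π n m) :
    ∃ γ : GammaTilde τ π n m, CosetSpace.mk m (lower a * vDot π n d * c) =
      MulOpposite.op γ • CosetSpace.mk m (lower a * vDot π n d * k) := by
  have hy1 := (mk_mem_variety_iff h.unif h.val_gal).1 (h.lang_mem m ha hk hg).1
  have e : lower a * vDot π n d * c = lower a * vDot π n d * k * (k⁻¹ * c) := by group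
  rw [mk_mem_variety_iff h.unif h.val_gal, e] at hx
  obtain ⟨γ, -, hγ⟩ := exists_smul_eq h.unif h.val_gal
    (mul_mem (inv_mem (iwahori_le_centerIwahori hk)) hc) hy1 hx
  exact ⟨γ, by rw [hγ, e]⟩

/-- The points of `X̃` are the points of the variety whose image in `GL₂(E) / Z(E) I_E` lies in the
locus `a₁ ≠ 0` of the Schubert cell. -/
theorem WildQuadratic.mem_varietyTilde_iff (h : WildQuadratic τ (π : E) ϖ d) (hd : Odd d) {n : ℕ}
    (hn : 1 ≤ n) {m : ℕ} {x : CosetSpace E m} :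
    x ∈ varietyTilde τ π n m d ↔ x ∈ variety τ π n m ∧ ∃ a, OrdEq (π : E) 1 a ∧
      ∃ c ∈ centerIwahori E, x = CosetSpace.mk m (lower a * vDot π n d * c) := by
  constructor
  · rintro ⟨y, ⟨hy, a, ha, k, hk, rfl⟩, γ, rfl⟩
    refine ⟨(variety τ π n m).smul_mem _ hy, a, (h.unif.hasOrd_iff).1 ha, ?_⟩
    obtain ⟨i, -, -, hi⟩ := gammaTilde_exists_rep γ
    exact ⟨k * i, mul_mem (iwahori_le_centerIwahori hk) i.2, by rw [hi, mul_assoc]⟩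
  · rintro ⟨hx, a, ha, c, hc, rfl⟩
    obtain ⟨z, x, -, -, hk, hg⟩ := h.exists_lang hd hn ha
    exact ⟨_, h.lang_mem m ha hk hg, h.exists_smul_lang ha hk hg hc hx⟩

end Cell


/-! ### Stability under `ι(Eˣ) I_F` -/

section Stability

theorem baseGL_apply {F E : Type*} [Field F] [Field E] [Algebra F E] (g : GL (Fin 2) F) (i j : Fin 2) :
    baseGL F E g i j = algebraMap F E (g i j) := rfl

open ValuativeRel

theorem baseGL_mul_cell_val {F E : Type*} [Field F] [Field E] [Algebra F E] {π : Eˣ} {d : ℕ} {p s : E} {n : ℕ}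
    (hv : (vDot π n d : Matrix (Fin 2) (Fin 2) E) = !![0, p; s, 0]) (g : GL (Fin 2) F) (a : E) :
    ((baseGL F E g * (lower a * vDot π n d) : GL (Fin 2) E) : Matrix (Fin 2) (Fin 2) E) =
      !![algebraMap F E (g 0 1) * s, (algebraMap F E (g 0 0) + algebraMap F E (g 0 1) * a) * p;
        algebraMap F E (g 1 1) * s, (algebraMap F E (g 1 0) + algebraMap F E (g 1 1) * a) * p] := by
  rw [Units.val_mul, lower_vDot_val hv, Matrix.eta_fin_two (baseGL F E g : Matrix _ _ E),
    Matrix.mul_fin_two, baseGL_apply, baseGL_apply, baseGL_apply, baseGL_apply]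
  ext i j
  fin_cases i <;> fin_cases j <;> simp <;> ring

variable {F E : Type*} [Field F] [Field E] [ValuativeRel E] [Algebra F E]
  {τ : E ≃ₐ[F] E} {π : Eˣ} {ϖ : F} {d : ℕ}

/-- Here `a'` is the image of `a` under the Möbius transformation attached to `g`. With this choice
the matrix in the conclusion is lower triangular, and division by the automorphy factor `x` puts it
in `I_E` under the two bounds. -/
theorem base_mul_cell (hπ : IsUnif (π : E)) (hd : Odd d) {n : ℕ} {g : GL (Fin 2) F} {a a' x : E}
    (hx0 : x ≠ 0) (hx : algebraMap F E (g 0 0) + algebraMap F E (g 0 1) * a = x)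
    (ha' : algebraMap F E (g 1 0) + algebraMap F E (g 1 1) * a = a' * x)
    (h0 : OrdEq (π : E) 0 ((algebraMap F E (g 1 1) - a' * algebraMap F E (g 0 1)) / x))
    (h1 : algebraMap F E (g 0 1) / x ∈ fracPow (π : E) (-(n + d))) :
    (lower a' * vDot π n d)⁻¹ * (baseGL F E g * (lower a * vDot π n d)) ∈ centerIwahori E := by
  obtain ⟨p, s, i, j, hp, hs, hij, hv, hv'⟩ := exists_vDot_eq (π := π) hd n
  have hp0 := hp.ne_zero hπ
  have hs0 := hs.ne_zero hπ
  refine mem_centerIwahori_iff.2 ⟨(Units.mk0 x hx0)⁻¹, ?_⟩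
  rw [hπ.mem_iwahori_iff, scalar_mul_apply, scalar_mul_apply, scalar_mul_apply, scalar_mul_apply,
    lower_vDot_inv_mul hv', baseGL_mul_cell_val hv, hx, ha']
  simp only [Matrix.of_apply, Matrix.cons_val', Matrix.cons_val_zero, Matrix.cons_val_one,
    Matrix.cons_val_fin_one, Units.val_inv_eq_inv_val, Units.val_mk0]
  refine ⟨?_, ?_, ?_, ?_⟩
  · convert h0 using 1
    field_simp
  · convert zero_mem (fracPow (π : E) 0) using 1
    ring
  · have := hπ.mul_mem h1 (hs.div hπ hp).mem (k := 1) (by omega)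
    convert this using 1
    field_simp
  · convert ordEq_one (π : E) using 1
    field_simp

/-- The case where the diagonal of `g` dominates: numerator and denominator of `a'` are led by `g₁₁
a` and `g₀₀`. -/
theorem base_mul_cell_even (hπ : IsUnif (π : E)) (hd : Odd d) (n : ℕ) {g : GL (Fin 2) F} {a : E}
    (ha : OrdEq (π : E) 1 a) {k : ℤ} (h00 : OrdEq (π : E) k (algebraMap F E (g 0 0)))
    (h01 : algebraMap F E (g 0 1) ∈ fracPow (π : E) k)
    (h10 : algebraMap F E (g 1 0) ∈ fracPow (π : E) (k + 2))
    (h11 : OrdEq (π : E) k (algebraMap F E (g 1 1))) :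
    ∃ a', OrdEq (π : E) 1 a' ∧
      (lower a' * vDot π n d)⁻¹ * (baseGL F E g * (lower a * vDot π n d)) ∈ centerIwahori E := by
  have hx : OrdEq (π : E) k (algebraMap F E (g 0 0) + algebraMap F E (g 0 1) * a) :=
    h00.add hπ (hπ.mul_mem h01 ha.mem le_rfl) (by omega)
  have hy : OrdEq (π : E) (k + 1) (algebraMap F E (g 1 0) + algebraMap F E (g 1 1) * a) := by
    rw [add_comm (algebraMap F E (g 1 0))]
    exact (h11.mul hπ ha).add hπ h10 (by omega)
  have ha' := hy.div hπ hx
  rw [add_sub_cancel_left] at ha'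
  refine ⟨_, ha', base_mul_cell hπ hd (hx.ne_zero hπ) rfl
    (div_mul_cancel₀ _ (hx.ne_zero hπ)).symm ?_ ?_⟩
  · have := (h11.sub hπ (hπ.mul_mem ha'.mem h01 (le_refl (1 + k))) (by omega)).div hπ hx
    rwa [sub_self] at this
  · rw [div_eq_mul_inv]
    exact hπ.mul_mem h01 hx.inv.mem (by omega)

/-- The case where the antidiagonal of `g` dominates, as for `ι(π)`: numerator and denominator of
`a'` are led by `g₁₀` and `g₀₁ a`. -/
theorem base_mul_cell_odd (hπ : IsUnif (π : E)) (hd : Odd d) (n : ℕ) {g : GL (Fin 2) F} {a : E}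
    (ha : OrdEq (π : E) 1 a) {k : ℤ} (h00 : algebraMap F E (g 0 0) ∈ fracPow (π : E) (k + 2))
    (h01 : OrdEq (π : E) k (algebraMap F E (g 0 1)))
    (h10 : OrdEq (π : E) (k + 2) (algebraMap F E (g 1 0)))
    (h11 : algebraMap F E (g 1 1) ∈ fracPow (π : E) (k + 2)) :
    ∃ a', OrdEq (π : E) 1 a' ∧
      (lower a' * vDot π n d)⁻¹ * (baseGL F E g * (lower a * vDot π n d)) ∈ centerIwahori E := by
  have hx : OrdEq (π : E) (k + 1) (algebraMap F E (g 0 0) + algebraMap F E (g 0 1) * a) := by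
    rw [add_comm (algebraMap F E (g 0 0))]
    exact (h01.mul hπ ha).add hπ h00 (by omega)
  have hy : OrdEq (π : E) (k + 2) (algebraMap F E (g 1 0) + algebraMap F E (g 1 1) * a) :=
    h10.add hπ (hπ.mul_mem h11 ha.mem le_rfl) (by omega)
  have ha' := hy.div hπ hx
  rw [show k + 2 - (k + 1) = 1 by omega] at ha'
  have ha'' := ha'.mul hπ h01
  have hd' := hd.pos
  refine ⟨_, ha', base_mul_cell hπ hd (hx.ne_zero hπ) rfl
    (div_mul_cancel₀ _ (hx.ne_zero hπ)).symm ?_ ?_⟩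
  · have := ((ha''.sub hπ h11 (by omega)).neg).div hπ hx
    rw [neg_sub, add_comm 1 k, sub_self] at this
    exact this
  · exact (h01.div hπ hx).mem_of_le hπ (by omega)

variable [ValuativeRel F]

theorem WildQuadratic.smul_mem_varietyTilde (h : WildQuadratic τ (π : E) ϖ d) (hd : Odd d) {n : ℕ}
    (hn : 1 ≤ n) (m : ℕ) {g : GL (Fin 2) F}
    (hg : ∀ a : E, OrdEq (π : E) 1 a → ∃ a', OrdEq (π : E) 1 a' ∧
      (lower a' * vDot π n d)⁻¹ * (baseGL F E g * (lower a * vDot π n d)) ∈ centerIwahori E) :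
    ∀ x ∈ varietyTilde τ π n m d, g • x ∈ varietyTilde τ π n m d := by
  intro x hx
  obtain ⟨hx, a, ha, c, hc, rfl⟩ := (h.mem_varietyTilde_iff hd hn).1 hx
  obtain ⟨a', ha', hc'⟩ := hg a ha
  refine (h.mem_varietyTilde_iff hd hn).2 ⟨smul_mem_variety τ π n m g _ hx, a', ha', _,
    mul_mem hc' hc, ?_⟩
  rw [smul_mk]
  congr 1
  group

theorem WildQuadratic.iwahori_mul_cell (h : WildQuadratic τ (π : E) ϖ d) (hd : Odd d) (n : ℕ)
    {g : GL (Fin 2) F} (hg : g ∈ iwahori F) {a : E} (ha : OrdEq (π : E) 1 a) :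
    ∃ a', OrdEq (π : E) 1 a' ∧
      (lower a' * vDot π n d)⁻¹ * (baseGL F E g * (lower a * vDot π n d)) ∈ centerIwahori E := by
  obtain ⟨h1, h2, h3, h4⟩ := h.unif_base.mem_iwahori_iff.1 hg
  exact base_mul_cell_even h.unif hd n ha (h.ord_base _ _ h1) ((h.mem_base _ _).2 h2)
    ((h.mem_base _ _).2 h3) (h.ord_base _ _ h4)

variable [TopologicalSpace F] [IsNonarchimedeanLocalField F]

theorem WildQuadratic.torus_mul_cell (h : WildQuadratic τ (π : E) ϖ d) (hd : Odd d) (n : ℕ)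
    {ι : E →ₐ[F] Matrix (Fin 2) (Fin 2) F} {Δ : F} (hΔ : Δ ∈ fracPow ϖ 1)
    (hι : ι (π : E) = !![Δ, 1; ϖ, 0]) (e : Eˣ) {a : E} (ha : OrdEq (π : E) 1 a) :
    ∃ a', OrdEq (π : E) 1 a' ∧ (lower a' * vDot π n d)⁻¹ *
      (baseGL F E (Units.map (ι : E →* Matrix (Fin 2) (Fin 2) F) e) * (lower a * vDot π n d)) ∈
        centerIwahori E := by
  obtain ⟨u, w, he⟩ := h.exists_eq e
  have hval : ((Units.map (ι : E →* Matrix (Fin 2) (Fin 2) F) e : GL (Fin 2) F) :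
      Matrix (Fin 2) (Fin 2) F) = !![u + w * Δ, w; w * ϖ, u] := by
    rw [Units.coe_map]
    change ι (e : E) = _
    rw [he, map_add, map_mul, AlgHom.commutes, AlgHom.commutes, hι]
    ext i j
    fin_cases i <;> fin_cases j <;>
      simp [Matrix.mul_apply, Matrix.algebraMap_matrix_apply]
  have uE := h.unif
  have hϖ : OrdEq (π : E) 2 (algebraMap F E ϖ) := by
    simpa using h.ord_base ϖ 1 (ordEq_self ϖ)
  have hΔ' : algebraMap F E Δ ∈ fracPow (π : E) 2 := (h.mem_base _ 1).2 hΔ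
  -- For `e = u + w π` the first case is even order (`u` leads, diagonal dominant), the second odd
  -- order (`w π` leads, antidiagonal dominant).
  by_cases hcase : valuation F w ≤ valuation F u
  · have hu0 : u ≠ 0 := by
      rintro rfl
      rw [map_zero, le_zero_iff, Valuation.zero_iff] at hcase
      subst hcase
      simp at he
    obtain ⟨k, hk⟩ := h.unif_base.exists_ordEq hu0
    have hw : algebraMap F E w ∈ fracPow (π : E) (2 * k) :=
      (h.mem_base _ _).2 (hcase.trans hk.mem)
    have hk' := h.ord_base _ _ hk
    refine base_mul_cell_even uE hd n ha (k := 2 * k) ?_ ?_ ?_ ?_ <;> rw [hval]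
    · change OrdEq _ _ (algebraMap F E (u + w * Δ))
      rw [map_add, map_mul]
      exact hk'.add uE (uE.mul_mem hw hΔ' le_rfl) (by omega)
    · exact hw
    · change algebraMap F E (w * ϖ) ∈ _
      rw [map_mul]
      exact uE.mul_mem hw hϖ.mem le_rfl
    · exact hk'
  · rw [not_le] at hcase
    have hw0 : w ≠ 0 := by
      rintro rfl
      simp at hcase
    obtain ⟨k, hk⟩ := h.unif_base.exists_ordEq hw0
    have hk' := h.ord_base _ _ hk
    have hu : u ∈ fracPow ϖ (k + 1) := by
      by_cases hu0 : u = 0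
      · rw [hu0]; exact zero_mem _
      obtain ⟨j, hj⟩ := h.unif_base.exists_ordEq hu0
      refine hj.mem_of_le h.unif_base ?_
      by_contra hlt
      exact hcase.not_ge (hk.mem_of_le h.unif_base (by omega : j ≤ k) |>.trans hj.ge)
    have hu' : algebraMap F E u ∈ fracPow (π : E) (2 * k + 2) := by
      have := (h.mem_base _ _).2 hu
      rwa [mul_add, mul_one] at this
    refine base_mul_cell_odd uE hd n ha (k := 2 * k) ?_ ?_ ?_ ?_ <;> rw [hval]
    · change algebraMap F E (u + w * Δ) ∈ _
      rw [map_add, map_mul]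
      exact add_mem hu' (uE.mul_mem hk'.mem hΔ' le_rfl)
    · exact hk'
    · change OrdEq _ _ (algebraMap F E (w * ϖ))
      rw [map_mul]
      exact hk'.mul uE hϖ
    · exact hu'

theorem WildQuadratic.torusIwahori_smul_mem (h : WildQuadratic τ (π : E) ϖ d) (hd : Odd d) {n : ℕ}
    (hn : 1 ≤ n) (m : ℕ) {ι : E →ₐ[F] Matrix (Fin 2) (Fin 2) F} {Δ : F} (hΔ : Δ ∈ fracPow ϖ 1)
    (hι : ι (π : E) = !![Δ, 1; ϖ, 0]) (g : torusIwahori ι) :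
    ∀ x ∈ varietyTilde τ π n m d, g • x ∈ varietyTilde τ π n m d := by
  obtain ⟨g, hg⟩ := g
  change ∀ x ∈ varietyTilde τ π n m d, g • x ∈ varietyTilde τ π n m d
  have gen : ∀ g ∈ ((Units.map (ι : E →* Matrix (Fin 2) (Fin 2) F)).range ∪ iwahori F :
      Set (GL (Fin 2) F)), ∀ x ∈ varietyTilde τ π n m d, g • x ∈ varietyTilde τ π n m d := by
    rintro g (⟨e, rfl⟩ | hg)
    · exact h.smul_mem_varietyTilde hd hn m fun a ha => h.torus_mul_cell hd n hΔ hι e ha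
    · exact h.smul_mem_varietyTilde hd hn m fun a ha => h.iwahori_mul_cell hd n hg ha
  rw [torusIwahori, Subgroup.sup_eq_closure] at hg
  induction hg using Subgroup.closure_induction'' with
  | mem x hx => exact gen x hx
  | inv_mem x hx => exact gen _ (hx.imp inv_mem inv_mem)
  | one => simp
  | mul x y _ _ hx hy =>
    intro z hz
    rw [mul_smul]
    exact hx _ (hy _ hz)

end Stability


/-! ### Elements of `Γ̃` -/

section Gamma

open ValuativeRel
open scoped commutatorElement

theorem diag_mul_unipotent {E : Type*} [Field E] {i i' : GL (Fin 2) E} {y y' z z' : E} (t s : Eˣ)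
    (hi : (i : Matrix (Fin 2) (Fin 2) E) = !![1, y; z, 1])
    (hi' : (i' : Matrix (Fin 2) (Fin 2) E) = !![1, y'; z', 1])
    (hy : (t : E) * y = y' * s) (hz : (s : E) * z = z' * t) : diag t s * i = i' * diag t s := by
  refine Units.ext ?_
  rw [Units.val_mul, Units.val_mul, hi, hi', val_diag, Matrix.mul_fin_two, Matrix.mul_fin_two]
  ext a b
  fin_cases a <;> fin_cases b <;> simp [hy, hz]

variable {F E : Type*} [Field F] [ValuativeRel F] [Field E] [ValuativeRel E] [Algebra F E]
  {τ : E ≃ₐ[F] E} {π : Eˣ} {ϖ : F} {d : ℕ}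

theorem WildQuadratic.mem_preGamma (h : WildQuadratic τ (π : E) ϖ d) {n m : ℕ}
    {i : centerIwahori E} (hi : wDot τ π n * galGL τ i = i * wDot τ π n) :
    i ∈ preGamma τ π n m := by
  refine mem_preGamma_of h.unif h.val_gal wDot_mem ?_
  rw [mul_assoc, hi, inv_mul_cancel_left]
  exact wDot_mem

theorem WildQuadratic.diag_mem_centerIwahori (h : WildQuadratic τ (π : E) ϖ d) (t : Eˣ) :
    diag t (galUnit τ t) ∈ centerIwahori E := by
  refine mem_centerIwahori_iff.2 ⟨t⁻¹, ?_⟩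
  rw [h.unif.mem_iwahori_iff, scalar_mul_apply, scalar_mul_apply, scalar_mul_apply,
    scalar_mul_apply, val_diag]
  simp only [Matrix.of_apply, Matrix.cons_val', Matrix.cons_val_zero, Matrix.cons_val_one,
    Matrix.cons_val_fin_one, mul_zero, Units.inv_mul]
  refine ⟨ordEq_one _, zero_mem _, zero_mem _, ?_⟩
  have ht : valuation E (t : E) ≠ 0 := by
    rw [Ne, Valuation.zero_iff]
    exact t.ne_zero
  rw [OrdEq, zpow_zero, map_mul, Units.val_inv_eq_inv_val, map_inv₀]
  change (valuation E t)⁻¹ * valuation E (τ t) = 1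
  rw [h.val_gal, inv_mul_cancel₀ ht]

theorem WildQuadratic.diag_mem_preGamma (h : WildQuadratic τ (π : E) ϖ d) (n m : ℕ) (t : Eˣ) :
    (⟨_, h.diag_mem_centerIwahori t⟩ : centerIwahori E) ∈ preGamma τ π n m := by
  obtain ⟨α, β, -, -, -, -, hw⟩ := h.exists_wDot_eq n
  refine h.mem_preGamma (Units.ext ?_)
  have hg : ((galGL τ (diag t (galUnit τ t)) : GL (Fin 2) E) : Matrix (Fin 2) (Fin 2) E) =
      !![τ t, 0; 0, (t : E)] := by
    ext i j
    rw [galGL_apply, val_diag]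
    fin_cases i <;> fin_cases j
    · rfl
    · exact map_zero τ
    · exact map_zero τ
    · exact h.gal_gal t
  rw [Units.val_mul, Units.val_mul, hw, hg, val_diag, Matrix.mul_fin_two, Matrix.mul_fin_two]
  have : ((galUnit τ t : Eˣ) : E) = τ t := rfl
  rw [this]
  ext i j
  fin_cases i <;> fin_cases j <;> simp [mul_comm]

theorem WildQuadratic.norm_mul_mem (h : WildQuadratic τ (π : E) ϖ d) {n : ℕ} {i k : ℤ} {y : E}
    (hy : y ∈ fracPow (π : E) i) (hk : k ≤ 2 * n + i) :
    algebraMap F E ϖ ^ n * y ∈ fracPow (π : E) k := by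
  have h1 : OrdEq (π : E) 2 (algebraMap F E ϖ) := by simpa using h.ord_base ϖ 1 (ordEq_self ϖ)
  exact h.unif.mul_mem (h1.pow n).mem hy hk

theorem WildQuadratic.gal_mem_fracPow (h : WildQuadratic τ (π : E) ϖ d) {k : ℤ} {y : E} :
    τ y ∈ fracPow (π : E) k ↔ y ∈ fracPow (π : E) k := by
  rw [mem_fracPow, mem_fracPow, h.val_gal]

/-- The elements `[[1, y], [ϖ ^ n τ(y), 1]]` of the `τ`-centralizer of `ẇ`. -/
theorem WildQuadratic.exists_unipotent (h : WildQuadratic τ (π : E) ϖ d) {n : ℕ} (hn : 1 ≤ n)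
    {y : E} (hy : y ∈ fracPow (π : E) 0) :
    ∃ i ∈ iwahori E, (i : Matrix (Fin 2) (Fin 2) E) = !![1, y; algebraMap F E ϖ ^ n * τ y, 1] ∧
      wDot τ π n * galGL τ i = i * wDot τ π n := by
  obtain ⟨α, β, -, -, -, hβ, hw⟩ := h.exists_wDot_eq n
  have hz : algebraMap F E ϖ ^ n * τ y ∈ fracPow (π : E) 1 :=
    h.norm_mul_mem (h.gal_mem_fracPow.2 hy) (by omega)
  have hdet : Matrix.det !![1, y; algebraMap F E ϖ ^ n * τ y, 1] ≠ 0 := by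
    rw [Matrix.det_fin_two_of, mul_one]
    exact ((ordEq_one (π : E)).sub h.unif (h.unif.mul_mem hy hz (le_refl (0 + 1)))
      (by norm_num)).ne_zero h.unif
  have hval : ((Matrix.GeneralLinearGroup.mkOfDetNeZero _ hdet : GL (Fin 2) E) :
      Matrix (Fin 2) (Fin 2) E) = !![1, y; algebraMap F E ϖ ^ n * τ y, 1] := rfl
  refine ⟨_, ?_, hval, Units.ext ?_⟩
  · rw [h.unif.mem_iwahori_iff, hval]
    exact ⟨ordEq_one _, hy, hz, ordEq_one _⟩
  · have hg : ((galGL τ (Matrix.GeneralLinearGroup.mkOfDetNeZero _ hdet) : GL (Fin 2) E) :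
        Matrix (Fin 2) (Fin 2) E) = !![1, τ y; algebraMap F E ϖ ^ n * y, 1] := by
      ext i j
      rw [galGL_apply, hval]
      fin_cases i <;> fin_cases j <;> simp [h.gal_gal]
    rw [Units.val_mul, Units.val_mul, hw, hg, hval, Matrix.mul_fin_two, Matrix.mul_fin_two, hβ]
    ext i j
    fin_cases i <;> fin_cases j <;> simp <;> ring

/-- Every upper triangular unipotent with entry in `𝔭 ^ (n + d)` is congruent modulo `J` to a
commutator in `Γ̃`. -/
theorem WildQuadratic.exists_commutator (h : WildQuadratic τ (π : E) ϖ d) {n m : ℕ} (hn : 1 ≤ n)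
    (hm : m + 1 = 2 * n + d) {Q : GL (Fin 2) E} (hQ : Q ∈ iwahori E)
    (h00 : Q 0 0 - 1 ∈ fracPow (π : E) (m + 1)) (h01 : Q 0 1 ∈ fracPow (π : E) (n + d))
    (h10 : Q 1 0 ∈ fracPow (π : E) (m + 1)) (h11 : Q 1 1 - 1 ∈ fracPow (π : E) (m + 1)) :
    ∃ γ γ' : GammaTilde τ π n m, ∀ g : GL (Fin 2) E,
      CosetSpace.mk m (g * Q) = MulOpposite.op ⁅γ, γ'⁆ • CosetSpace.mk m g := by
  have uE := h.unif
  have hπ0 : (π : E) ≠ 0 := π.ne_zero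
  have hη0 : τ (π : E) ≠ 0 := (map_ne_zero τ).2 hπ0
  have hη : OrdEq (π : E) 1 (τ π) := by rw [OrdEq, h.val_gal, zpow_one]
  have hε : OrdEq (π : E) d ((π - τ π) / τ π) := by
    have := ((h.ord_diff _ (ordEq_self (π : E))).neg).div uE hη
    rwa [neg_sub, add_sub_cancel_right] at this
  have hε0 : (π - τ π : E) ≠ 0 := by
    have := h.ord_diff _ (ordEq_self (π : E))
    rw [← neg_sub]
    exact neg_ne_zero.2 (this.ne_zero uE)
  -- Conjugation by `diag(π, τ(π))` turns `y` into `y' = y π / τ(π)`, and `y' - y = y (π - τ(π)) /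
  -- τ(π)`. The factor has order `d`, so prescribing the difference `Q₀₁ ∈ 𝔭 ^ (n + d)` yields `y ∈
  -- 𝔭 ^ n`.
  obtain ⟨y, hy⟩ : ∃ y, y = Q 0 1 / ((π - τ π) / τ π) := ⟨_, rfl⟩
  obtain ⟨y', hy'⟩ : ∃ y', y' = y * π / τ π := ⟨_, rfl⟩
  have hyn : y ∈ fracPow (π : E) n := by
    rw [hy, div_eq_mul_inv]
    exact uE.mul_mem h01 hε.inv.mem (by omega)
  have hyn' : y' ∈ fracPow (π : E) n := by
    rw [hy', mul_div_assoc]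
    exact uE.mul_mem hyn ((ordEq_self (π : E)).div uE hη).mem (by omega)
  have hsub : Q 0 1 = y' - y := by
    rw [hy', hy]
    field_simp
  obtain ⟨i, hi, hiv, hiw⟩ := h.exists_unipotent hn (uE.fracPow_anti (by omega) hyn)
  obtain ⟨i', hi', hiv', -⟩ := h.exists_unipotent hn (uE.fracPow_anti (by omega) hyn')
  let γi : GammaTilde τ π n m := ⟨_, ⟨_, iwahori_le_centerIwahori hi⟩, h.mem_preGamma hiw, rfl⟩
  let γd : GammaTilde τ π n m := ⟨_, _, h.diag_mem_preGamma n m π, rfl⟩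
  have hconj : diag π (galUnit τ π) * i = i' * diag π (galUnit τ π) := by
    refine diag_mul_unipotent _ _ hiv hiv' ?_ ?_
    · change (π : E) * y = y' * τ π
      rw [hy']
      field_simp
    · change τ (π : E) * _ = _
      rw [hy', map_div₀, map_mul, h.gal_gal]
      field_simp
  -- The commutator of `i⁻¹` with the diagonal matrix is `i⁻¹ i'`; it remains to compare `i Q` with
  -- `i'` entry by entry modulo `J`.
  refine ⟨γi⁻¹, γd, fun g => ?_⟩
  have hact : MulOpposite.op ⁅γi⁻¹, γd⁆ • CosetSpace.mk m g = CosetSpace.mk m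
      (g * (i⁻¹ * diag π (galUnit τ π) * i⁻¹⁻¹ * (diag π (galUnit τ π))⁻¹)) := rfl
  have hval : ((i * Q : GL (Fin 2) E) : Matrix (Fin 2) (Fin 2) E) =
      !![Q 0 0 + y * Q 1 0, Q 0 1 + y * Q 1 1;
        algebraMap F E ϖ ^ n * τ y * Q 0 0 + Q 1 0,
        algebraMap F E ϖ ^ n * τ y * Q 0 1 + Q 1 1] := by
    rw [Units.val_mul, hiv, Matrix.eta_fin_two (Q : Matrix (Fin 2) (Fin 2) E), Matrix.mul_fin_two]
    simp
  rw [hact, inv_inv, mul_assoc i⁻¹, hconj, mul_assoc i⁻¹, mul_inv_cancel_right, CosetSpace.mk_eq]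
  have e : (g * Q)⁻¹ * (g * (i⁻¹ * i')) = (i * Q)⁻¹ * i' := by group
  have hτy := h.gal_mem_fracPow.2 hyn
  rw [e]
  refine inv_mul_mem_iwahoriLevel (mul_mem hi hQ) hi' ?_
  rw [← neg_sub]
  refine neg_mem (uE.mem_chainPow_odd.2 ?_)
  simp only [Matrix.sub_apply, hval, hiv', Matrix.of_apply, Matrix.cons_val', Matrix.cons_val_zero,
    Matrix.cons_val_one, Matrix.cons_val_fin_one]
  refine ⟨?_, ?_, ?_, ?_⟩
  · rw [add_sub_right_comm]
    exact add_mem h00 (uE.mul_mem hyn h10 (by omega))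
  · have : Q 0 1 + y * Q 1 1 - y' = y * (Q 1 1 - 1) := by rw [hsub]; ring
    rw [this]
    exact uE.mul_mem hyn h11 (by omega)
  · have : algebraMap F E ϖ ^ n * τ y * Q 0 0 + Q 1 0 - algebraMap F E ϖ ^ n * τ y' =
        algebraMap F E ϖ ^ n * τ y * (Q 0 0 - 1) - algebraMap F E ϖ ^ n * τ (Q 0 1) + Q 1 0 := by
      rw [hsub, map_sub]; ring
    rw [this]
    exact add_mem (sub_mem (uE.mul_mem (h.norm_mul_mem hτy (le_refl (2 * n + n : ℤ))) h00 (by omega))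
      (h.norm_mul_mem (h.gal_mem_fracPow.2 h01) (by omega))) h10
  · rw [add_sub_assoc]
    exact add_mem (uE.mul_mem (h.norm_mul_mem hτy (le_refl (2 * n + n : ℤ))) h01 (by omega)) h11

/-- `I_F ^ (m + d + 1)` moves the points of `X̃` by commutators of `Γ̃`. -/
theorem WildQuadratic.exists_smul_eq_commutator (h : WildQuadratic τ (π : E) ϖ d) (hd : Odd d)
    {n m : ℕ} (hn : 1 ≤ n) (hm : m + 1 = 2 * n + d) {g : GL (Fin 2) F}
    (hg : g ∈ iwahoriLevel F (m + d + 1)) {y : CosetSpace E m} (hy : y ∈ varietyTilde τ π n m d) :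
    ∃ γ γ' δ : GammaTilde τ π n m, g • y = MulOpposite.op (δ⁻¹ * ⁅γ, γ'⁆ * δ) • y := by
  have uE := h.unif
  obtain ⟨hyX, a, ha, c, hc, rfl⟩ := (h.mem_varietyTilde_iff hd hn).1 hy
  obtain ⟨z, x, hz, hx, hk, hlang⟩ := h.exists_lang hd hn ha
  obtain ⟨δ, hδ⟩ := h.exists_smul_lang ha hk hlang hc hyX
  obtain ⟨p, s, i, j, hp, hs, hij, hv, hv'⟩ := exists_vDot_eq (π := π) hd n
  have hp0 := hp.ne_zero uE
  have hs0 := hs.ne_zero uE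
  have hx0 := x.ne_zero
  obtain ⟨-, hg⟩ := hg
  -- The level is even, so in `E` the entries of `g - 1` have order at least `2(n + d)`, and the
  -- lower left one at least `2(n + d) + 2`.
  have hlev : m + d + 1 = 2 * (n + d) := by omega
  have hl1 : (2 * (n + d) + 1) / 2 = n + d := by omega
  have hl2 : 2 * (n + d) / 2 = n + d := by omega
  rw [hlev, h.unif_base.mem_chainPow_iff, hl1, hl2, ← h.mem_base, ← h.mem_base, ← h.mem_base,
    ← h.mem_base] at hg
  simp only [Matrix.sub_apply, Matrix.one_apply_eq, map_sub, map_one, ne_eq, zero_ne_one,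
    one_ne_zero, not_false_eq_true, Matrix.one_apply_ne, sub_zero, Nat.cast_add,
    Nat.cast_one] at hg
  obtain ⟨g1, g2, g3, g4⟩ := hg
  set P := algebraMap F E (g 0 0)
  set Q := algebraMap F E (g 0 1)
  set R := algebraMap F E (g 1 0)
  set S := algebraMap F E (g 1 1)
  have hkv : ((lower z * diag x 1 : GL (Fin 2) E) : Matrix (Fin 2) (Fin 2) E) =
      !![(x : E), 0; z * x, 1] := by
    rw [Units.val_mul, val_lower, val_diag, Matrix.mul_fin_two]
    simp
  have hkv' : ((lower z * diag x 1)⁻¹ : GL (Fin 2) E).1 = !![(x : E)⁻¹, 0; -z, 1] := by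
    have : ((diag x 1)⁻¹ : GL (Fin 2) E).1 = !![((x⁻¹ : Eˣ) : E), 0; 0, ((1⁻¹ : Eˣ) : E)] := rfl
    rw [mul_inv_rev, Units.val_mul, val_inv_lower, this, Matrix.mul_fin_two]
    simp
  set k := lower z * diag x 1 with hkdef
  set N := (lower a * vDot π n d)⁻¹ * (baseGL F E g * (lower a * vDot π n d)) with hN
  have hNv : (N : Matrix (Fin 2) (Fin 2) E) = !![1 + (S - 1 - a * Q),
      p / s * (R + (S - 1 - (P - 1)) * a - a * Q * a); s / p * Q, 1 + (P - 1 + Q * a)] := by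
    rw [hN, lower_vDot_inv_mul hv', baseGL_mul_cell_val hv]
    ext i j
    fin_cases i <;> fin_cases j <;> simp <;> field_simp <;> ring
  obtain ⟨n1, hn1⟩ : ∃ n1, n1 = S - 1 - a * Q := ⟨_, rfl⟩
  obtain ⟨n2, hn2⟩ : ∃ n2, n2 = p / s * (R + (S - 1 - (P - 1)) * a - a * Q * a) := ⟨_, rfl⟩
  obtain ⟨n3, hn3⟩ : ∃ n3, n3 = s / p * Q := ⟨_, rfl⟩
  obtain ⟨n4, hn4⟩ : ∃ n4, n4 = P - 1 + Q * a := ⟨_, rfl⟩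
  rw [← hn1, ← hn2, ← hn3, ← hn4] at hNv
  have m1 : n1 ∈ fracPow (π : E) (m + 1) := by
    rw [hn1]
    exact sub_mem (uE.fracPow_anti (by omega) g4) (uE.mul_mem ha.mem g2 (by omega))
  have m2 : n2 ∈ fracPow (π : E) (n + d) := by
    rw [hn2]
    -- The critical entry: the factor `p / s` costs `n + d + 1`, while `ord a = 1` gains one in the
    -- terms with `P`, `Q`, `S`, leaving `n + d`. The other entries of `N - 1` already lie in `𝔭 ^
    -- (m + 1)`.
    refine uE.mul_mem (j := 2 * (n + d) + 1) (hp.div uE hs).mem (sub_mem (add_mem ?_ ?_) ?_)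
      (by omega)
    · exact uE.fracPow_anti (by omega) g3
    · exact uE.mul_mem (sub_mem g4 g1) ha.mem le_rfl
    · exact uE.mul_mem (uE.mul_mem ha.mem g2 le_rfl) ha.mem (by omega)
  have m3 : n3 ∈ fracPow (π : E) (m + 1) := by
    rw [hn3]
    exact uE.mul_mem (hs.div uE hp).mem g2 (by omega)
  have m4 : n4 ∈ fracPow (π : E) (m + 1) := by
    rw [hn4]
    exact add_mem (uE.fracPow_anti (by omega) g1) (uE.mul_mem g2 ha.mem (by omega))
  have hQv : ((k⁻¹ * N * k : GL (Fin 2) E) : Matrix (Fin 2) (Fin 2) E) =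
      !![1 + (n1 + n2 * z), (x : E)⁻¹ * n2;
        x * (n3 + n4 * z - z * (n1 + n2 * z)), 1 + (n4 - z * n2)] := by
    rw [Units.val_mul, Units.val_mul, hkv, hkv', hNv, Matrix.mul_fin_two, Matrix.mul_fin_two]
    ext i j
    fin_cases i <;> fin_cases j <;> simp <;> field_simp <;> ring
  have q1 : n1 + n2 * z ∈ fracPow (π : E) (m + 1) := add_mem m1 (uE.mul_mem m2 hz (by omega))
  have q2 : (x : E)⁻¹ * n2 ∈ fracPow (π : E) (n + d) := uE.mul_mem hx.inv.mem m2 (by omega)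
  have q3 : x * (n3 + n4 * z - z * (n1 + n2 * z)) ∈ fracPow (π : E) (m + 1) :=
    uE.mul_mem hx.mem (sub_mem (add_mem m3 (uE.mul_mem m4 hz (by omega)))
      (uE.mul_mem hz q1 (by omega))) (by omega : (m + 1 : ℤ) ≤ 0 + (m + 1))
  have q4 : n4 - z * n2 ∈ fracPow (π : E) (m + 1) := sub_mem m4 (uE.mul_mem hz m2 (by omega))
  obtain ⟨γ, γ', hγ⟩ := h.exists_commutator hn hm (Q := k⁻¹ * N * k) (by
      rw [uE.mem_iwahori_iff, hQv]
      exact ⟨(ordEq_one _).add uE q1 (by omega), uE.fracPow_anti (by omega) q2,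
        uE.fracPow_anti (by omega) q3, (ordEq_one _).add uE q4 (by omega)⟩)
    (by rw [hQv]; simpa using q1) (by rw [hQv]; exact q2) (by rw [hQv]; exact q3)
    (by rw [hQv]; simpa using q4)
  refine ⟨γ, γ', δ, ?_⟩
  -- The point is the `δ`-translate of the Lang point, on which `g` acts as the commutator; hence
  -- the conjugate by `δ`.
  have eδ : δ * (δ⁻¹ * ⁅γ, γ'⁆ * δ) = ⁅γ, γ'⁆ * δ := by rw [mul_assoc δ⁻¹, mul_inv_cancel_left]
  have eN : baseGL F E g * (lower a * vDot π n d * k) =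
      lower a * vDot π n d * k * (k⁻¹ * N * k) := by rw [hN]; group
  rw [hδ, smul_comm, smul_mk, eN, hγ, smul_smul, smul_smul, ← MulOpposite.op_mul,
    ← MulOpposite.op_mul, eδ]

end Gamma


/-! ### Counting the orbits -/

section Count

open ValuativeRel

/-- The classes to be counted are the complement of the kernel of reduction to the residue field;
that kernel has index `q` in a ring with `q ^ N` elements. -/
theorem card_not_mem_maximalIdeal {R : Type*} [CommRing R] [IsDomain R] [IsDiscreteValuationRing R]
    [Finite (IsLocalRing.ResidueField R)] {N : ℕ} (hN : 1 ≤ N) :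
    Finite (R ⧸ IsLocalRing.maximalIdeal R ^ N) ∧
    Nat.card {t : R ⧸ IsLocalRing.maximalIdeal R ^ N //
      ¬ Ideal.Quotient.factor (Ideal.pow_le_self (by omega : N ≠ 0)) t = 0} =
      (Nat.card (IsLocalRing.ResidueField R) - 1) *
        Nat.card (IsLocalRing.ResidueField R) ^ (N - 1) := by
  have hcard : Nat.card (R ⧸ IsLocalRing.maximalIdeal R ^ N) =
      Nat.card (IsLocalRing.ResidueField R) ^ N :=
    cardQuot_pow_of_prime (IsDiscreteValuationRing.not_a_field R)
  have hq : 0 < Nat.card (IsLocalRing.ResidueField R) := Nat.card_pos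
  have hfin : Finite (R ⧸ IsLocalRing.maximalIdeal R ^ N) := by
    refine Nat.finite_of_card_ne_zero ?_
    rw [hcard]
    positivity
  refine ⟨hfin, ?_⟩
  let f : R ⧸ IsLocalRing.maximalIdeal R ^ N →+* R ⧸ IsLocalRing.maximalIdeal R :=
    Ideal.Quotient.factor (Ideal.pow_le_self (by omega : N ≠ 0))
  have hf : Function.Surjective f := Ideal.Quotient.factor_surjective _
  have h1 : Nat.card {t // f t = 0} * Nat.card (IsLocalRing.ResidueField R) =
      Nat.card (IsLocalRing.ResidueField R) ^ N := by
    rw [← hcard, mul_comm, AddSubgroup.card_eq_card_quotient_mul_card_addSubgroup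
      (RingHom.ker f).toAddSubgroup]
    congr 1
    exact (Nat.card_congr (RingHom.quotientKerEquivOfSurjective hf).toEquiv).symm
  have h2 : Nat.card {t // f t = 0} + Nat.card {t // ¬ f t = 0} =
      Nat.card (IsLocalRing.ResidueField R) ^ N := by
    classical
    rw [← hcard, ← Nat.card_sum]
    exact Nat.card_congr (Equiv.sumCompl fun t => f t = 0)
  have hp : Nat.card (IsLocalRing.ResidueField R) ^ N =
      Nat.card (IsLocalRing.ResidueField R) ^ (N - 1) * Nat.card (IsLocalRing.ResidueField R) := by
    rw [← pow_succ, Nat.sub_add_cancel hN]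
  rw [hp] at h1 h2
  have h3 := Nat.eq_of_mul_eq_mul_right hq h1
  change Nat.card {t // ¬ f t = 0} = _
  rw [Nat.sub_mul, one_mul, mul_comm (Nat.card (IsLocalRing.ResidueField R)),
    ← h2, h3, Nat.add_sub_cancel_left]

variable {F E : Type*} [Field F] [ValuativeRel F] [Field E] [ValuativeRel E] [Algebra F E]
  {τ : E ≃ₐ[F] E} {π : Eˣ} {ϖ : F} {d : ℕ}

theorem mk_mem_pow_iff {L : Type*} [Field L] [ValuativeRel L] {π : L} (hπ : IsUnif π) {u w : 𝒪[L]}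
    {N : ℕ} : u - w ∈ 𝓂[L] ^ N ↔ (u : L) - w ∈ fracPow π N := by
  rw [← hπ.mem_maxPow_iff]
  constructor
  · intro h
    exact ⟨u - w, h, rfl⟩
  · rintro ⟨y, hy, hyu⟩
    have : y = u - w := Subtype.ext hyu
    rwa [← this]

/-- The `Γ̃`-orbits on `X̃` are parametrized by the units of `𝒪_E / 𝔭_E ^ (n + d)`. -/
theorem WildQuadratic.exists_orbit_param (h : WildQuadratic τ (π : E) ϖ d) (hd : Odd d)
    {n : ℕ} (hn : 1 ≤ n) (m : ℕ) :
    ∃ s : {t : 𝒪[E] ⧸ 𝓂[E] ^ (n + d) //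
        ¬ Ideal.Quotient.factor (Ideal.pow_le_self (by omega : n + d ≠ 0)) t = 0} →
        varietyTilde τ π n m d,
      (∀ y, ∃ i, ∃ γ : GammaTilde τ π n m, y = MulOpposite.op γ • s i) ∧
      ∀ i j, ∀ γ : GammaTilde τ π n m, s i = MulOpposite.op γ • s j → i = j := by
  have uE := h.unif
  have hrep : ∀ t : {t : 𝒪[E] ⧸ 𝓂[E] ^ (n + d) //
      ¬ Ideal.Quotient.factor (Ideal.pow_le_self (by omega : n + d ≠ 0)) t = 0},
      ∃ u : 𝒪[E], Ideal.Quotient.mk _ u = t.1 ∧ OrdEq (π : E) 1 ((u : E) * π) := by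
    rintro ⟨t, ht⟩
    obtain ⟨u, rfl⟩ := Ideal.Quotient.mk_surjective t
    refine ⟨u, rfl, ?_⟩
    rw [Ideal.Quotient.factor_mk, Ideal.Quotient.eq_zero_iff_mem, mem_maxIdeal_iff, not_lt] at ht
    have hu : OrdEq (π : E) 0 (u : E) := by
      rw [OrdEq, zpow_zero]
      exact le_antisymm u.2 ht
    simpa using hu.mul uE (ordEq_self (π : E))
  choose u hu hord using hrep
  choose z x _ _ hk hlang using fun t => h.exists_lang hd hn (hord t)
  let s : {t : 𝒪[E] ⧸ 𝓂[E] ^ (n + d) //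
      ¬ Ideal.Quotient.factor (Ideal.pow_le_self (by omega : n + d ≠ 0)) t = 0} →
      varietyTilde τ π n m d := fun t =>
    ⟨CosetSpace.mk m (lower ((u t : E) * π) * vDot π n d * (lower (z t) * diag (x t) 1)),
      _, h.lang_mem m (hord t) (hk t) (hlang t), 1, (one_smul _ _).symm⟩
  refine ⟨s, ?_, ?_⟩
  · rintro ⟨y, hy⟩
    obtain ⟨hyX, b, hb, c, hc, rfl⟩ := (h.mem_varietyTilde_iff hd hn).1 hy
    have hbu : OrdEq (π : E) 0 (b / π) := by simpa using hb.div uE (ordEq_self (π : E))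
    have hbu1 : valuation E (b / π) = 1 := by simpa [OrdEq] using hbu
    let t : {t : 𝒪[E] ⧸ 𝓂[E] ^ (n + d) //
        ¬ Ideal.Quotient.factor (Ideal.pow_le_self (by omega : n + d ≠ 0)) t = 0} :=
      ⟨Ideal.Quotient.mk _ ⟨b / π, hbu1.le⟩, by
        rw [Ideal.Quotient.factor_mk, Ideal.Quotient.eq_zero_iff_mem, mem_maxIdeal_iff, not_lt]
        exact hbu1.ge⟩
    -- A congruence of `b / π` modulo `𝔭 ^ (n + d)` is one of `b` modulo `𝔭 ^ (n + d + 1)`, which is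
    -- equality in the cell.
    have hsub : b - (u t : E) * π ∈ fracPow (π : E) (n + d + 1) := by
      have h1 : (⟨b / π, hbu1.le⟩ : 𝒪[E]) - u t ∈ 𝓂[E] ^ (n + d) :=
        Ideal.Quotient.eq.1 (hu t).symm
      rw [mk_mem_pow_iff uE] at h1
      have h2 := uE.mul_mem h1 (ordEq_self (π : E)).mem (k := n + d + 1) (by push_cast; omega)
      convert h2 using 1
      rw [sub_mul, div_mul_cancel₀ _ π.ne_zero]
    obtain ⟨c', hc', e⟩ := exists_cell_eq uE hd hsub
    have e' : lower b * vDot π n d * c = lower ((u t : E) * π) * vDot π n d * (c' * c) := by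
      rw [e, mul_assoc]
    rw [e'] at hyX
    obtain ⟨γ, hγ⟩ := h.exists_smul_lang (hord t) (hk t) (hlang t)
      (mul_mem (iwahori_le_centerIwahori hc') hc) hyX
    exact ⟨t, γ, Subtype.ext ((congrArg _ e').trans hγ)⟩
  · intro i j γ hij
    have hij' : CosetSpace.mk m (lower ((u i : E) * π) * vDot π n d * (lower (z i) * diag (x i) 1)) =
      MulOpposite.op γ •
        CosetSpace.mk m (lower ((u j : E) * π) * vDot π n d * (lower (z j) * diag (x j) 1)) :=
      congrArg Subtype.val hij
    obtain ⟨c, -, -, hγ⟩ := gammaTilde_exists_rep γ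
    rw [hγ, CosetSpace.mk_eq] at hij'
    have hsub := sub_mem_of_cell_eq (a := (u i : E) * π) (b := (u j : E) * π) uE hd
      (mul_mem (iwahori_le_centerIwahori (hk i)) (iwahori_le_centerIwahori hij'.1))
      (mul_mem (iwahori_le_centerIwahori (hk j)) c.2) (n := n) (by group)
    refine Subtype.ext ?_
    rw [← hu i, ← hu j, eq_comm, Ideal.Quotient.eq, mk_mem_pow_iff uE]
    have h2 := uE.mul_mem hsub (ordEq_self (π : E)).inv.mem (k := ((n + d : ℕ) : ℤ))
      (by push_cast; omega)
    convert h2 using 1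
    rw [← sub_mul, mul_inv_cancel_right₀ π.ne_zero]

end Count


/-! ### The representations `R_θ̃` and `Ξ_θ̃` -/

section Representations

theorem gammaTilde_free_subtype {F E : Type*} [Field F] [Field E] [ValuativeRel E]
    [Algebra F E] {τ : E ≃ₐ[F] E} {π : Eˣ} {n m : ℕ}
    {Y : SubMulAction (GammaTilde τ π n m)ᵐᵒᵖ (CosetSpace E m)}
    (y : Y) (γ : GammaTilde τ π n m) (h : MulOpposite.op γ • y = y) : γ = 1 :=
  gammaTilde_free (y : CosetSpace E m) γ (congrArg Subtype.val h)

variable {F E : Type*} [Field F] [ValuativeRel F] [Field E] [ValuativeRel E] [Algebra F E]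
  {τ : E ≃ₐ[F] E} {π : Eˣ} {ϖ : F} {d : ℕ} {K : Type*} [Field K]

theorem WildQuadratic.nonempty_variety (h : WildQuadratic τ (π : E) ϖ d) (hd : Odd d) {n : ℕ}
    (hn : 1 ≤ n) (m : ℕ) : Nonempty (variety τ π n m) := by
  obtain ⟨z, x, -, -, hk, hg⟩ := h.exists_lang hd hn (ordEq_self (π : E))
  exact ⟨⟨_, (h.lang_mem m (ordEq_self (π : E)) hk hg).1⟩⟩

/-- For `z ∈ Fˣ` the scalar matrix equals `diag(t, τ(t))` with `t = z`, since `τ` fixes `F`. Being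
central, it moves every point as this element of `Γ̃` does from the right. -/
theorem WildQuadratic.isCentralCharacter (h : WildQuadratic τ (π : E) ϖ d) (hd : Odd d) {n m : ℕ}
    (hn : 1 ≤ n) (θ : Eˣ →* Kˣ) (θt : GammaTilde τ π n m →* Kˣ)
    (hlift : ∀ (t : Eˣ) (γ : GammaTilde τ π n m) (i : centerIwahori E),
      (i : GL (Fin 2) E) = diag t (galUnit τ t) →
      (γ : LevelQuotient E m) = QuotientGroup.mk i → θt γ = θ t) :
    IsCentralCharacter (repR θt) (θ.comp (Units.map (algebraMap F E : F →* E))) := by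
  have := h.nonempty_variety hd hn m
  refine ⟨isotypicPart_nontrivial θt gammaTilde_free_subtype, fun z v => ?_⟩
  let t : Eˣ := Units.map (algebraMap F E : F →* E) z
  let γ : GammaTilde τ π n m := ⟨_, _, h.diag_mem_preGamma n m t, rfl⟩
  have ht : galUnit τ t = t := Units.ext (τ.commutes z)
  have hscal : baseGL F E (Matrix.GeneralLinearGroup.scalar (Fin 2) z) =
      Matrix.GeneralLinearGroup.scalar (Fin 2) t :=
    Matrix.GeneralLinearGroup.map_scalar (algebraMap F E) z
  have hdiag : diag t (galUnit τ t) = Matrix.GeneralLinearGroup.scalar (Fin 2) t := by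
    rw [ht]
    refine Units.ext ?_
    rw [val_diag, Matrix.GeneralLinearGroup.coe_scalar]
    ext i j
    fin_cases i <;> fin_cases j <;> simp
  have key := isotypicRep_eq_smul (smul_mem_variety τ π n m) θt
    (Matrix.GeneralLinearGroup.scalar (Fin 2) z) (θ t : K) fun y _ => ⟨γ, ?_, ?_⟩
  · exact LinearMap.congr_fun key v
  · obtain ⟨g, rfl⟩ := y.mk_surjective
    change CosetSpace.mk m _ = CosetSpace.mk m (g * diag t (galUnit τ t))
    rw [hscal, hdiag, Subgroup.mem_center_iff.1 (scalar_mem_center t) g]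
  · rw [hlift t γ _ rfl rfl]

/-- Each point is moved by a conjugate of a commutator of `Γ̃`, on which a character with
commutative target is trivial. -/
theorem WildQuadratic.repXi_eq_id (h : WildQuadratic τ (π : E) ϖ d) (hd : Odd d) {n m : ℕ}
    (hn : 1 ≤ n) (hm : m + 1 = 2 * n + d) (θt : GammaTilde τ π n m →* Kˣ)
    {ι : E →ₐ[F] Matrix (Fin 2) (Fin 2) F}
    (hst : ∀ g : torusIwahori ι, ∀ x ∈ varietyTilde τ π n m d, g • x ∈ varietyTilde τ π n m d)
    (g : torusIwahori ι) (hg : (g : GL (Fin 2) F) ∈ iwahoriLevel F (m + d + 1)) :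
    repXi ι d θt hst g = LinearMap.id := by
  have key := isotypicRep_eq_smul hst θt g 1 fun y hy => ?_
  · rw [one_smul] at key
    exact key
  · obtain ⟨γ, γ', δ, e⟩ := h.exists_smul_eq_commutator hd hn hm hg hy
    refine ⟨_, e, ?_⟩
    rw [map_mul, map_mul, map_inv, map_commutatorElement, commutatorElement_eq_one_iff_mul_comm.2
      (mul_comm _ _), mul_one, inv_mul_cancel, Units.val_one]

theorem WildQuadratic.finrank_spaceV [TopologicalSpace E] [IsNonarchimedeanLocalField E]
    (h : WildQuadratic τ (π : E) ϖ d) (hd : Odd d) {n m : ℕ} (hn : 1 ≤ n)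
    (θt : GammaTilde τ π n m →* Kˣ) :
    Module.Finite K (SpaceV d θt) ∧ Module.finrank K (SpaceV d θt) =
      (Nat.card 𝓀[F] - 1) * Nat.card 𝓀[F] ^ (n + d - 1) := by
  obtain ⟨s, hs, hi⟩ := h.exists_orbit_param hd hn m
  obtain ⟨hfin, hcard⟩ := card_not_mem_maximalIdeal (R := 𝒪[E]) (N := n + d) (by omega)
  let e := isotypicEquiv θt (freeEquiv s hs hi gammaTilde_free_subtype)
    (freeEquiv_mul s hs hi gammaTilde_free_subtype)
  have := Fintype.ofFinite {t : 𝒪[E] ⧸ 𝓂[E] ^ (n + d) //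
    ¬ Ideal.Quotient.factor (Ideal.pow_le_self (by omega : n + d ≠ 0)) t = 0}
  refine ⟨Module.Finite.equiv e.symm, ?_⟩
  rw [e.finrank_eq, Module.finrank_finsupp_self, ← Nat.card_eq_fintype_card, hcard,
    ← h.card_residue]

end Representations

end WildGL2

theorem mainTheorem12
    {F E : Type*}
    [Field F] [ValuativeRel F] [TopologicalSpace F] [IsNonarchimedeanLocalField F] [CharP F 2]
    [Field E] [ValuativeRel E] [TopologicalSpace E] [IsNonarchimedeanLocalField E]
    [Algebra F E] [ValuativeExtension F E]
    (hdeg : Module.finrank F E = 2) (τ : E ≃ₐ[F] E) (hτ : τ ≠ AlgEquiv.refl)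
    (d : ℕ) (hd : Odd d)
    (ϖ Δ : F) (π : Eˣ) (hϖ : WildGL2.HasOrd ϖ 1) (hπ : WildGL2.HasOrd (π : E) 1)
    (hΔ : WildGL2.HasOrd Δ ((d + 1) / 2))
    (hmin : (π : E) ^ 2 + algebraMap F E Δ * (π : E) + algebraMap F E ϖ = 0)
    (ι : E →ₐ[F] Matrix (Fin 2) (Fin 2) F) (hι : ι (π : E) = !![Δ, 1; ϖ, 0])
    (n m : ℕ) (hm : m + 1 = 2 * n + d) (hn : d < 2 * n)
    (ℓ : ℕ) [Fact ℓ.Prime]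
    (θ : Eˣ →* (PadicAlgCl ℓ)ˣ) (hθ : WildGL2.HasLevel θ m)
    (θt : WildGL2.GammaTilde τ π n m →* (PadicAlgCl ℓ)ˣ)
    (hlift : ∀ (t : Eˣ) (γ : WildGL2.GammaTilde τ π n m) (i : WildGL2.centerIwahori E),
      (i : GL (Fin 2) E) = WildGL2.diag t (WildGL2.galUnit τ t) →
      (γ : WildGL2.LevelQuotient E m) = QuotientGroup.mk i → θt γ = θ t) :
    WildGL2.IsCentralCharacter (WildGL2.repR θt)
      (θ.comp (Units.map (algebraMap F E : F →* E))) ∧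
    (∃ h : ∀ g : WildGL2.torusIwahori ι, ∀ x ∈ WildGL2.varietyTilde τ π n m d,
        g • x ∈ WildGL2.varietyTilde τ π n m d,
      ∀ g : WildGL2.torusIwahori ι,
        (g : GL (Fin 2) F) ∈ WildGL2.iwahoriLevel F (m + d + 1) →
        WildGL2.repXi ι d θt h g = LinearMap.id) ∧
    Module.Finite (PadicAlgCl ℓ) (WildGL2.SpaceV d θt) ∧
    Module.finrank (PadicAlgCl ℓ) (WildGL2.SpaceV d θt) =
      (Nat.card 𝓀[F] - 1) * Nat.card 𝓀[F] ^ (n + d - 1) := by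
  have hπu := hπ.isUnif
  have hϖu := hϖ.isUnif
  have h := WildGL2.wildQuadratic_of_minpoly hdeg τ hτ hd hϖ hπ hΔ hmin
  have hn1 : 1 ≤ n := by omega
  have hΔ1 : Δ ∈ WildGL2.fracPow ϖ 1 := by
    have := hd.pos
    exact (hϖu.hasOrd_iff.1 hΔ).mem_of_le hϖu (by omega)
  exact ⟨h.isCentralCharacter hd hn1 θ θt hlift,
    ⟨h.torusIwahori_smul_mem hd hn1 m hΔ1 hι,
      fun g hg => h.repXi_eq_id hd hn1 hm θt _ g hg⟩,
    h.finrank_spaceV hd hn1 θt⟩
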